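/- All Banach spaces are complex, and for a Banach space $E$ the dual $E^*$ is the space of bounded conjugate-linear functionals on $E$ (with this convention the adjoint of multiplication by a scalar $\lambda$ is multiplication by $\overline\lambda$). **Setting.** Let $U,X,Y$ be Banach spaces. A *system node* $\Sigma(A,B,C,\mathbf G)$ on $(U,X,Y)$ consists of the generator $A:\mathrm D(A)\subset X\to X$ of a $C_0$-semigroup $\mathbb T$ on $X$ with growth bound $\omega(\mathbb T)$, operators $B\in\mathcal L(U,X_{-1})$ and $C\in\mathcal L(X_1,Y)$, and an analytic function $\mathbf G:\mathbb C_{\omega(\mathbb T)}=\{\operatorname{Re}s>\omega(\mathbb T)\}\to\mathcal L(U,Y)$ with $\mathbf G(\alpha)-\mathbf G(\gamma)=C[R(\alpha,A)-R(\gamma,A)]B$ for all $\alpha,\gamma\in\mathbb C_{\omega(\mathbb T)}$. Here, for a fixed $\beta\in\mathbb C_{\omega(\mathbb T)}$, $X_1$ is $\mathrm D(A)$ with the norm $\|(\beta-A)x\|$, $X_{-1}$ is the completion of $X$ for the norm $\|R(\beta,A)x\|$, and $A$, $R(s,A)$, $\mathbb T(t)$ are extended continuously to maps $X\to X_{-1}$,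 $X_{-1}\to X$, $X_{-1}\to X_{-1}$. On $\mathrm D(C\&D)=\{(x,u)\in X\times U: Ax+Bu\in X\}$ put $C\&D(x,u)=C[x-R(\beta,A)Bu]+\mathbf G(\beta)u$. A *classical solution* is a triple $(u,x,y)$ with $u\in C([0,\infty),U)$, $x\in C^1([0,\infty),X)$, $y\in C([0,\infty),Y)$ such that for all $t\ge0$: $(x(t),u(t))\in\mathrm D(C\&D)$, $\dot x(t)=Ax(t)+Bu(t)$ and $y(t)=C\&D(x(t),u(t))$. A *generalised solution* is a triple $(u,x,y)$ with $u\in L^1_{\mathrm{loc}}([0,\infty),U)$, $x\in C([0,\infty),X_{-1})$, $x(t)=\mathbb T(t)x_0+\int_0^t\mathbb T(t-s)Bu(s)\,ds$ for some $x_0\in X$, and $y$ the $Y$-valued distribution $y=\frac{d^2}{dt^2}F$, where $F(t)=C\&D\int_0^t(t-s)(x(s),u(s))\,ds$ for $t\ge0$ and $F(t)=0$ for $t<0$. The node is *$C^\infty$-LILO stable* if there is $c>0$ such that for every classical solution with $u\in C_c^\infty((0,\infty),U)$ and $x(0)=0$ one has $y\in L^1_{\mathrm{loc}}([0,\infty),Y)$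 and $\|y\|_{L^1([0,t],Y)}\le c\|u\|_{L^1([0,t],U)}$ for all $t>0$. It is *$C^\infty$-BIBO stable* if the same holds with $L^\infty$ in place of $L^1$. It is *$L^\infty$-BIBO stable* if there is $c>0$ such that for every generalised solution with $u\in L^\infty_{\mathrm{loc}}([0,\infty),U)$ and $x(0)=0$ the distribution $y$ is a (strongly measurable) function in $L^\infty_{\mathrm{loc}}([0,\infty),Y)$ and $\|y\|_{L^\infty([0,t],Y)}\le c\|u\|_{L^\infty([0,t],U)}$ for all $t>0$. If $A^*$ generates a $C_0$-semigroup on $X^*$, the *dual node* is the system node $\Sigma(A^*,C^*,B^*,\overline{\mathbf G}(\overline{\,\cdot\,}))$ on $(Y^*,X^*,U^*)$, where $\overline{\mathbf G}(\overline{s})$ denotes $\mathbf G(\overline s)^*\in\mathcal L(Y^*,U^*)$, and $C^*\in\mathcal L(Y^*,(X^*)_{-1})$, $B^*\in\mathcal L((X^*)_1,U^*)$ are the adjoints with respect to the dualities $(X_1)^*=(X^*)_{-1}$ and $(X_{-1})^*=(X^*)_1$ that extend the pairing of $X^*$ and $X$. **Theorem.** Let $\Sigma(A,B,C,\mathbf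 G)$ be a $C^\infty$-LILO stable system node on $(U,X,Y)$ such that $A^*$ generates a $C_0$-semigroup. Then the dual node $\Sigma(A^*,C^*,B^*,\overline{\mathbf G}(\overline{\,\cdot\,}))$ is $C^\infty$-BIBO stable. If in addition $U^*$ has the Radon–Nikodým property, then the dual node is $L^\infty$-BIBO stable. -/

import Mathlib

open Set Filter Topology MeasureTheory
open scoped ENNReal NNReal ContDiff ComplexConjugate Distributions

noncomputable section

namespace LinSys

/-- A strongly continuous semigroup on `X`. Only the values `T t` with `0 ≤ t` are meaningful. -/
structure C0Semigroup (X : Type*) [NormedAddCommGroup X] [NormedSpace ℂ X] where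
  T : ℝ → X →L[ℂ] X
  map_zero : T 0 = ContinuousLinearMap.id ℂ X
  map_add : ∀ s t, 0 ≤ s → 0 ≤ t → T (s + t) = (T s).comp (T t)
  continuousOn_orbit : ∀ x, ContinuousOn (fun t => T t x) (Ici 0)

section Generator

variable {X : Type*} [NormedAddCommGroup X] [NormedSpace ℂ X]

/-- The orbit of `x` has the right derivative `z` at time `0`. -/
def C0Semigroup.HasGen (S : C0Semigroup X) (x z : X) : Prop :=
  Tendsto (fun t : ℝ => t⁻¹ • (S.T t x - x)) (𝓝[>] 0) (𝓝 z)

/-- The unbounded operator `A` is the infinitesimal generator of `S`, with its full domain. -/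
def C0Semigroup.IsGenerator (S : C0Semigroup X) (A : X →ₗ.[ℂ] X) : Prop :=
  ∀ x z, (x, z) ∈ A.graph ↔ S.HasGen x z

/-- The unbounded operator `A` generates a strongly continuous semigroup. -/
def GeneratesC0 (A : X →ₗ.[ℂ] X) : Prop :=
  ∃ S : C0Semigroup X, S.IsGenerator A

/-- The growth bound `ω(T) = inf {a | ∃ M, ∀ t ≥ 0, ‖T t‖ ≤ M e^{at}}`, possibly `-∞`. -/
def C0Semigroup.growthBound (S : C0Semigroup X) : EReal :=
  sInf {w : EReal | ∃ a : ℝ, w = a ∧ ∃ M : ℝ, ∀ t, 0 ≤ t → ‖S.T t‖ ≤ M * Real.exp (a * t)}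

/-- The open half-plane of all `s` with `Re s > ω(T)`. -/
def C0Semigroup.halfPlane (S : C0Semigroup X) : Set ℂ :=
  {s | S.growthBound < (s.re : EReal)}

/-- The bounded operator `R` is the inverse of `s - A : D(A) → X`. -/
def IsResolventAt (A : X →ₗ.[ℂ] X) (s : ℂ) (R : X →L[ℂ] X) : Prop :=
  (∀ x, ∃ h : R x ∈ A.domain, s • R x - A ⟨R x, h⟩ = x) ∧
    ∀ x : A.domain, R (s • (x : X) - A x) = x

/-- The resolvent set of an unbounded operator. -/
def resolventSet (A : X →ₗ.[ℂ] X) : Set ℂ :=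
  {s | ∃ R, IsResolventAt A s R}

open Classical in
/-- The resolvent `R(s, A) = (s - A)⁻¹` for `s` in the resolvent set (and `0` otherwise). -/
def resolvent (A : X →ₗ.[ℂ] X) (s : ℂ) : X →L[ℂ] X :=
  if h : ∃ R, IsResolventAt A s R then h.choose else 0

lemma IsResolventAt.unique {A : X →ₗ.[ℂ] X} {s : ℂ} {R R' : X →L[ℂ] X}
    (h : IsResolventAt A s R) (h' : IsResolventAt A s R') : R = R' := by
  ext x
  obtain ⟨hx, e⟩ := h'.1 x
  have := h.2 ⟨R' x, hx⟩
  rw [e] at this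
  exact this

lemma IsResolventAt.resolvent_eq {A : X →ₗ.[ℂ] X} {s : ℂ} {R : X →L[ℂ] X}
    (h : IsResolventAt A s R) : resolvent A s = R := by
  have h' : ∃ R, IsResolventAt A s R := ⟨R, h⟩
  unfold resolvent
  rw [dif_pos h']
  exact h'.choose_spec.unique h

lemma isResolventAt_resolvent {A : X →ₗ.[ℂ] X} {s : ℂ} (h : s ∈ resolventSet A) :
    IsResolventAt A s (resolvent A s) := by
  obtain ⟨R, hR⟩ := h
  rw [hR.resolvent_eq]
  exact hR

/-- The resolvent identity. -/
lemma IsResolventAt.identity {A : X →ₗ.[ℂ] X} {s r : ℂ} {R Q : X →L[ℂ] X}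
    (hR : IsResolventAt A s R) (hQ : IsResolventAt A r Q) (x : X) :
    Q x = R x + (s - r) • Q (R x) := by
  obtain ⟨hx, e⟩ := hR.1 x
  have h2 := hQ.2 ⟨R x, hx⟩
  have h3 : A ⟨R x, hx⟩ = s • R x - x := by
    rw [eq_sub_iff_add_eq, ← eq_sub_iff_add_eq']
    exact e.symm
  simp only [h3, map_sub, map_smul] at h2
  rw [sub_smul]
  rw [← sub_eq_zero] at h2 ⊢
  rw [← h2]
  abel

end Generator

section GeneratorFacts

variable {X : Type*} [NormedAddCommGroup X] [NormedSpace ℂ X] [CompleteSpace X]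

set_option linter.unusedSectionVars false

namespace C0Semigroup

/-- The orbit, extended continuously to negative times by a constant. -/
def orbit (S : C0Semigroup X) (x : X) (t : ℝ) : X := S.T (max t 0) x

lemma orbit_of_nonneg (S : C0Semigroup X) (x : X) {t : ℝ} (ht : 0 ≤ t) :
    S.orbit x t = S.T t x := by
  simp [orbit, ht]

lemma continuous_orbit (S : C0Semigroup X) (x : X) : Continuous (S.orbit x) :=
  (S.continuousOn_orbit x).comp_continuous (f := fun t : ℝ => max t 0) (by fun_prop)
    (fun _ => mem_Ici.2 (le_max_right _ _))

lemma exists_bound (S : C0Semigroup X) (a : ℝ) :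
    ∃ K, 0 ≤ K ∧ ∀ t, 0 ≤ t → t ≤ a → ‖S.T t‖ ≤ K := by
  obtain ⟨K, hK⟩ := banach_steinhaus (g := fun t : Icc (0 : ℝ) a => S.T t) (fun x => by
    have hc : IsCompact ((fun t => S.T t x) '' Icc 0 a) :=
      isCompact_Icc.image_of_continuousOn ((S.continuousOn_orbit x).mono Icc_subset_Ici_self)
    obtain ⟨C, hC⟩ := hc.isBounded.exists_norm_le
    exact ⟨C, fun t => hC _ ⟨t, t.2, rfl⟩⟩)
  exact ⟨max K 0, le_max_right _ _, fun t h0 h1 => (hK ⟨t, h0, h1⟩).trans (le_max_left _ _)⟩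

/-- The operator `x ↦ ∫₀ᵗ T(s) x ds`. -/
lemma exists_intOp (S : C0Semigroup X) (t : ℝ) (ht : 0 ≤ t) :
    ∃ J : X →L[ℂ] X, ∀ x, J x = ∫ s in (0 : ℝ)..t, S.orbit x s := by
  obtain ⟨K, hK0, hK⟩ := S.exists_bound t
  refine ⟨LinearMap.mkContinuous
    { toFun := fun x => ∫ s in (0 : ℝ)..t, S.orbit x s
      map_add' := fun x y => ?_
      map_smul' := fun c x => ?_ } (K * t) fun x => ?_, fun x => rfl⟩
  · rw [← intervalIntegral.integral_add ((S.continuous_orbit x).intervalIntegrable _ _)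
      ((S.continuous_orbit y).intervalIntegrable _ _)]
    simp [orbit]
  · simp only [orbit, map_smul, RingHom.id_apply]
    exact intervalIntegral.integral_smul c _
  · have := intervalIntegral.norm_integral_le_of_norm_le_const (a := 0) (b := t)
      (f := S.orbit x) (C := K * ‖x‖) (fun s hs => by
        rw [uIoc_of_le ht] at hs
        rw [S.orbit_of_nonneg x hs.1.le]
        exact (S.T s).le_of_opNorm_le (hK s hs.1.le hs.2) x)
    simp only [sub_zero, abs_of_nonneg ht] at this
    calc _ ≤ _ := this
      _ = _ := by ring

lemma hasGen_integral (S : C0Semigroup X) (t : ℝ) (ht : 0 ≤ t) (x : X) :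
    S.HasGen (∫ s in (0 : ℝ)..t, S.orbit x s) (S.T t x - x) := by
  have hc := S.continuous_orbit x
  have hi : ∀ a b, IntervalIntegrable (S.orbit x) volume a b := fun a b =>
    hc.intervalIntegrable a b
  have key : ∀ h : ℝ, 0 < h →
      h⁻¹ • (S.T h (∫ s in (0 : ℝ)..t, S.orbit x s) - ∫ s in (0 : ℝ)..t, S.orbit x s)
      = h⁻¹ • ((∫ s in (0:ℝ)..(t + h), S.orbit x s) - (∫ s in (0:ℝ)..t, S.orbit x s))
        - h⁻¹ • ((∫ s in (0:ℝ)..(0 + h), S.orbit x s) - (∫ s in (0:ℝ)..0, S.orbit x s)) := by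
    intro h hh
    have e1 : S.T h (∫ s in (0 : ℝ)..t, S.orbit x s) = ∫ s in (h : ℝ)..(t + h), S.orbit x s := by
      rw [← ContinuousLinearMap.intervalIntegral_comp_comm _ (hi _ _)]
      have : ∫ s in (0:ℝ)..t, S.T h (S.orbit x s) = ∫ s in (0:ℝ)..t, S.orbit x (s + h) := by
        apply intervalIntegral.integral_congr
        intro s hs
        rw [uIcc_of_le ht] at hs
        simp only
        rw [S.orbit_of_nonneg x hs.1, S.orbit_of_nonneg x (add_nonneg hs.1 hh.le), add_comm s h,
          S.map_add h s hh.le hs.1]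
        rfl
      rw [this, intervalIntegral.integral_comp_add_right (S.orbit x) h, zero_add]
    have e2 := intervalIntegral.integral_add_adjacent_intervals (hi 0 h) (hi h (t + h))
    rw [e1, ← smul_sub, ← e2]
    congr 1
    simp only [zero_add, intervalIntegral.integral_same, sub_zero]
    abel
  have d : ∀ a : ℝ, Tendsto (fun h : ℝ => h⁻¹ • ((∫ s in (0:ℝ)..(a + h), S.orbit x s)
      - (∫ s in (0:ℝ)..a, S.orbit x s))) (𝓝[>] 0) (𝓝 (S.orbit x a)) := fun a =>
    (intervalIntegral.integral_hasDerivAt_right (hi 0 a)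
      (hc.stronglyMeasurableAtFilter _ _) hc.continuousAt).tendsto_slope_zero_right
  have := (d t).sub (d 0)
  rw [S.orbit_of_nonneg x ht, S.orbit_of_nonneg x le_rfl, S.map_zero] at this
  refine this.congr' ?_
  filter_upwards [self_mem_nhdsWithin] with h hh
  exact (key h hh).symm

lemma integral_of_hasGen (S : C0Semigroup X) (t : ℝ) (ht : 0 ≤ t) {x z : X} (hx : S.HasGen x z) :
    ∫ s in (0 : ℝ)..t, S.orbit z s = S.T t x - x := by
  obtain ⟨J, hJ⟩ := S.exists_intOp t ht
  have h1 := S.hasGen_integral t ht x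
  have h2 := (J.continuous.tendsto z).comp hx
  rw [← hJ]
  refine tendsto_nhds_unique h2 (h1.congr' ?_)
  filter_upwards [self_mem_nhdsWithin] with h hh
  have hh : 0 < h := hh
  simp only [Function.comp]
  rw [← hJ, ContinuousLinearMap.map_smul_of_tower, map_sub]
  congr 2
  rw [hJ, hJ, ← ContinuousLinearMap.intervalIntegral_comp_comm _
    ((S.continuous_orbit x).intervalIntegrable _ _)]
  apply intervalIntegral.integral_congr
  intro s hs
  rw [uIcc_of_le ht] at hs
  simp only
  rw [S.orbit_of_nonneg _ hs.1, S.orbit_of_nonneg _ hs.1, ← ContinuousLinearMap.comp_apply,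
    ← ContinuousLinearMap.comp_apply, ← S.map_add _ _ hh.le hs.1, ← S.map_add _ _ hs.1 hh.le,
    add_comm]

/-- A generator is densely defined. -/
lemma IsGenerator.dense {S : C0Semigroup X} {A : X →ₗ.[ℂ] X} (h : S.IsGenerator A) :
    Dense (A.domain : Set X) := by
  intro x
  have hc := S.continuous_orbit x
  have d : Tendsto (fun h : ℝ => h⁻¹ • ((∫ s in (0:ℝ)..(0 + h), S.orbit x s)
      - (∫ s in (0:ℝ)..0, S.orbit x s))) (𝓝[>] 0) (𝓝 (S.orbit x 0)) :=
    (intervalIntegral.integral_hasDerivAt_right (hc.intervalIntegrable 0 0)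
      (hc.stronglyMeasurableAtFilter _ _) hc.continuousAt).tendsto_slope_zero_right
  rw [S.orbit_of_nonneg x le_rfl, S.map_zero] at d
  refine mem_closure_of_tendsto d ?_
  filter_upwards [self_mem_nhdsWithin] with t ht
  have ht : 0 < t := ht
  simp only [zero_add, intervalIntegral.integral_same, sub_zero]
  have : (∫ s in (0:ℝ)..t, S.orbit x s) ∈ A.domain :=
    LinearPMap.mem_domain_of_mem_graph ((h _ _).2 (S.hasGen_integral t ht.le x))
  exact (A.domain.restrictScalars ℝ).smul_mem t⁻¹ this

/-- The rescaled semigroup `e^{-st} T(t)`. -/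
def rescale (S : C0Semigroup X) (s : ℂ) : C0Semigroup X where
  T t := Complex.exp (-s * t) • S.T t
  map_zero := by simp [S.map_zero]
  map_add a b ha hb := by
    rw [S.map_add a b ha hb]
    ext x
    simp only [_root_.smul_apply, ContinuousLinearMap.comp_apply, map_smul, smul_smul]
    rw [← Complex.exp_add]
    push_cast
    ring_nf
  continuousOn_orbit x := by
    simp only [_root_.smul_apply]
    exact ContinuousOn.smul (by fun_prop) (S.continuousOn_orbit x)

lemma rescale_hasGen (S : C0Semigroup X) (s : ℂ) {x z : X} (h : S.HasGen x z) :
    (S.rescale s).HasGen x (z - s • x) := by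
  have hT : Tendsto (fun t : ℝ => S.T t x) (𝓝[>] 0) (𝓝 x) := by
    have := ((S.continuousOn_orbit x) 0 self_mem_Ici).mono Ioi_subset_Ici_self
    simpa [ContinuousWithinAt, S.map_zero] using this
  have hexp : HasDerivAt (fun t : ℝ => Complex.exp (-s * t)) (-s) 0 := by
    have h1 : HasDerivAt (fun t : ℂ => Complex.exp (-s * t)) (-s) ((0:ℝ):ℂ) := by
      have := ((hasDerivAt_id ((0:ℝ):ℂ)).const_mul (-s)).cexp
      simpa using this
    exact h1.comp_ofReal
  have h1 := hexp.tendsto_slope_zero_right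
  have h2 := (h1.smul hT).add h
  rw [neg_smul, neg_add_eq_sub] at h2
  refine h2.congr' ?_
  filter_upwards [self_mem_nhdsWithin] with t ht
  simp only [zero_add, rescale, _root_.smul_apply, Complex.ofReal_zero, mul_zero,
    Complex.exp_zero, smul_assoc, ← smul_add, sub_smul, one_smul]
  congr 1
  abel

lemma rescale_rescale (S : C0Semigroup X) (s : ℂ) (t : ℝ) :
    ((S.rescale s).rescale (-s)).T t = S.T t := by
  simp only [rescale, smul_smul, ← Complex.exp_add]
  simp

/-- The resolvent set of a generator contains the half-plane right of the growth bound. -/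
lemma IsGenerator.halfPlane_subset {S : C0Semigroup X} {A : X →ₗ.[ℂ] X} (h : S.IsGenerator A) :
    S.halfPlane ⊆ resolventSet A := by
  intro s hs
  have hs : S.growthBound < (s.re : EReal) := hs
  obtain ⟨w, ⟨a, rfl, M, hM⟩, hlt⟩ := sInf_lt_iff.1 hs
  have hlt : a < s.re := by exact_mod_cast hlt
  let V := S.rescale s
  obtain ⟨t, ht0, ht⟩ : ∃ t : ℝ, 0 ≤ t ∧ ‖V.T t‖ < 1 := by
    have lim : Tendsto (fun t : ℝ => M * Real.exp ((a - s.re) * t)) atTop (𝓝 0) := by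
      have : Tendsto (fun t : ℝ => Real.exp ((a - s.re) * t)) atTop (𝓝 0) :=
        Real.tendsto_exp_atBot.comp
          (tendsto_id.const_mul_atTop_of_neg (by linarith : a - s.re < 0))
      simpa using this.const_mul M
    obtain ⟨t, h1, h2⟩ := ((lim.eventually_lt_const one_pos).and (eventually_ge_atTop 0)).exists
    refine ⟨t, h2, lt_of_le_of_lt ?_ h1⟩
    simp only [V, rescale, norm_smul, Complex.norm_exp]
    calc Real.exp (-s * t : ℂ).re * ‖S.T t‖
        ≤ Real.exp (-s * t : ℂ).re * (M * Real.exp (a * t)) := by gcongr; exact hM t h2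
      _ = M * (Real.exp (-s.re * t) * Real.exp (a * t)) := by simp; ring
      _ = _ := by rw [← Real.exp_add]; ring_nf
  obtain ⟨J, hJ⟩ := V.exists_intOp t ht0
  let N : X →L[ℂ] X := ∑' n : ℕ, (V.T t) ^ n
  have hN1 : N * (1 - V.T t) = 1 := geom_series_mul_neg _ ht
  have hN2 : (1 - V.T t) * N = 1 := mul_neg_geom_series _ ht
  have hA : ∀ x : A.domain, V.HasGen x (A x - s • (x : X)) := fun x =>
    S.rescale_hasGen s ((h _ _).1 (LinearPMap.mem_graph A x))
  have hA2 : ∀ {x z}, V.HasGen x z → ∃ hx : x ∈ A.domain, A ⟨x, hx⟩ = z + s • x := by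
    intro x z hx
    have h1 := V.rescale_hasGen (-s) hx
    have h2 : S.HasGen x (z - (-s) • x) := by
      simpa only [HasGen, V, rescale_rescale] using h1
    have h3 := (h _ _).2 h2
    refine ⟨LinearPMap.mem_domain_of_mem_graph h3, ?_⟩
    rw [LinearPMap.mem_graph_iff] at h3
    obtain ⟨y, rfl, hy⟩ := h3
    simpa using hy
  refine ⟨J * N, fun x => ?_, fun x => ?_⟩
  · have := V.hasGen_integral t ht0 (N x)
    rw [← hJ] at this
    obtain ⟨hx, e⟩ := hA2 this
    refine ⟨hx, ?_⟩
    change s • J (N x) - A ⟨J (N x), hx⟩ = x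
    rw [e]
    have := congrArg (fun L : X →L[ℂ] X => L x) hN2
    simp at this
    calc s • J (N x) - (V.T t (N x) - N x + s • J (N x)) = N x - V.T t (N x) := by abel
      _ = x := this
  · have h1 := V.integral_of_hasGen t ht0 (hA x)
    rw [← hJ] at h1
    have hcomm : J * V.T t = V.T t * J := by
      ext y
      simp only [mul_apply_eq_comp, hJ]
      rw [← ContinuousLinearMap.intervalIntegral_comp_comm _
        ((V.continuous_orbit y).intervalIntegrable _ _)]
      apply intervalIntegral.integral_congr
      intro r hr
      rw [uIcc_of_le ht0] at hr
      simp only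
      rw [V.orbit_of_nonneg _ hr.1, V.orbit_of_nonneg _ hr.1, ← ContinuousLinearMap.comp_apply,
        ← ContinuousLinearMap.comp_apply, ← V.map_add _ _ ht0 hr.1, ← V.map_add _ _ hr.1 ht0,
        add_comm]
    have hJN : J * N = N * J := by
      have h3 : (1 - V.T t) * J = J * (1 - V.T t) := by
        rw [sub_mul, mul_sub, hcomm]; simp
      calc J * N = (N * (1 - V.T t)) * J * N := by rw [hN1, one_mul]
        _ = N * ((1 - V.T t) * J) * N := by rw [mul_assoc N]
        _ = N * J * ((1 - V.T t) * N) := by rw [h3]; simp only [mul_assoc]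
        _ = N * J := by rw [hN2, mul_one]
    rw [hJN, mul_apply_eq_comp]
    have h4 : J (s • (x : X) - A x) = (1 - V.T t) x := by
      rw [← neg_sub (A x), map_neg, h1]; simp
    rw [h4]
    have := congrArg (fun L : X →L[ℂ] X => L x) hN1
    simpa using this

end C0Semigroup

end GeneratorFacts

section Extrapolation

variable {X : Type*} [NormedAddCommGroup X] [NormedSpace ℂ X]

/-- The vector space `X`, to be equipped with the seminorm `x ↦ ‖R x‖`. -/
def PreExtra (_R : X →L[ℂ] X) : Type _ := X

instance (R : X →L[ℂ] X) : AddCommGroup (PreExtra R) := inferInstanceAs (AddCommGroup X)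

instance (R : X →L[ℂ] X) : Module ℂ (PreExtra R) := inferInstanceAs (Module ℂ X)

/-- `R` as a map on the copy of `X`. -/
def PreExtra.map (R : X →L[ℂ] X) : PreExtra R →ₗ[ℂ] X := R.toLinearMap

instance (R : X →L[ℂ] X) : SeminormedAddCommGroup (PreExtra R) :=
  SeminormedAddCommGroup.induced (PreExtra R) X (PreExtra.map R)

instance (R : X →L[ℂ] X) : NormedSpace ℂ (PreExtra R) :=
  NormedSpace.induced ℂ (PreExtra R) X (PreExtra.map R)

/-- The completion of `X` with respect to `x ↦ ‖R x‖`. For `R = R(β, A)` with `β ∈ ρ(A)` this is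
the extrapolation space `X₋₁`. -/
def Extra (R : X →L[ℂ] X) : Type _ := UniformSpace.Completion (PreExtra R)

instance (R : X →L[ℂ] X) : NormedAddCommGroup (Extra R) :=
  inferInstanceAs (NormedAddCommGroup (UniformSpace.Completion (PreExtra R)))

instance (R : X →L[ℂ] X) : NormedSpace ℂ (Extra R) :=
  inferInstanceAs (NormedSpace ℂ (UniformSpace.Completion (PreExtra R)))

instance (R : X →L[ℂ] X) : CompleteSpace (Extra R) :=
  inferInstanceAs (CompleteSpace (UniformSpace.Completion (PreExtra R)))

/-- The canonical map `X → X₋₁`. -/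
def toExtra (R : X →L[ℂ] X) : X →ₗ[ℂ] Extra R :=
  (UniformSpace.Completion.toComplL : PreExtra R →L[ℂ] UniformSpace.Completion (PreExtra R)).toLinearMap

lemma norm_toExtra (R : X →L[ℂ] X) (x : X) : ‖toExtra R x‖ = ‖R x‖ :=
  UniformSpace.Completion.norm_coe (E := PreExtra R) x

lemma denseRange_toExtra (R : X →L[ℂ] X) : DenseRange (toExtra R) :=
  UniformSpace.Completion.denseRange_coe (α := PreExtra R)

lemma IsResolventAt.apply_map {A : X →ₗ.[ℂ] X} {β : ℂ} {R : X →L[ℂ] X}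
    (hβ : IsResolventAt A β R) (x : A.domain) :
    R (A x) = β • R x - x := by
  have := hβ.2 x
  rw [map_sub, map_smul] at this
  rw [eq_sub_iff_add_eq, ← eq_sub_iff_add_eq']
  exact this.symm

variable [CompleteSpace X]

set_option linter.unusedSectionVars false

/-- The extension of `R(s, A)` to a bounded operator `X₋₁ → X`. -/
def extResolvent (A : X →ₗ.[ℂ] X) (β s : ℂ) : Extra (resolvent A β) →L[ℂ] X :=
  (resolvent A s).toLinearMap.extendOfNorm (toExtra (resolvent A β))

/-- The extension of `A` to a bounded operator `A₋₁ : X → X₋₁`. -/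
def extA (A : X →ₗ.[ℂ] X) (β : ℂ) : X →L[ℂ] Extra (resolvent A β) :=
  (toExtra (resolvent A β) ∘ₗ A.toFun).extendOfNorm A.domain.subtype

/-- The extension of `T(t)` to a bounded operator on `X₋₁`. -/
def extT (S : C0Semigroup X) (A : X →ₗ.[ℂ] X) (β : ℂ) (t : ℝ) :
    Extra (resolvent A β) →L[ℂ] Extra (resolvent A β) :=
  (toExtra (resolvent A β) ∘ₗ (S.T t).toLinearMap).extendOfNorm (toExtra (resolvent A β))

lemma extResolvent_self_toExtra (A : X →ₗ.[ℂ] X) (β : ℂ) (x : X) :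
    extResolvent A β β (toExtra _ x) = resolvent A β x :=
  LinearMap.extendOfNorm_eq (f := (resolvent A β).toLinearMap) (denseRange_toExtra _)
    ⟨1, fun x => by rw [norm_toExtra]; simp⟩ x

lemma norm_extResolvent_self (A : X →ₗ.[ℂ] X) (β : ℂ) (z : Extra (resolvent A β)) :
    ‖extResolvent A β β z‖ = ‖z‖ := by
  refine (denseRange_toExtra _).induction_on z (isClosed_eq (by fun_prop) (by fun_prop)) ?_
  intro x
  rw [extResolvent_self_toExtra, norm_toExtra]

lemma extResolvent_toExtra {A : X →ₗ.[ℂ] X} {β s : ℂ} (hβ : β ∈ resolventSet A)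
    (hs : s ∈ resolventSet A) (x : X) :
    extResolvent A β s (toExtra _ x) = resolvent A s x := by
  refine LinearMap.extendOfNorm_eq (f := (resolvent A s).toLinearMap) (denseRange_toExtra _)
    ⟨1 + ‖β - s‖ * ‖resolvent A s‖, fun x => ?_⟩ x
  rw [norm_toExtra]
  change ‖resolvent A s x‖ ≤ _
  rw [(isResolventAt_resolvent hβ).identity (isResolventAt_resolvent hs) x]
  refine (norm_add_le _ _).trans ?_
  rw [norm_smul, add_mul, one_mul, mul_assoc]
  gcongr
  exact (resolvent A s).le_opNorm _

lemma extResolvent_apply {A : X →ₗ.[ℂ] X} {β s : ℂ} (hβ : β ∈ resolventSet A)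
    (hs : s ∈ resolventSet A) (z : Extra (resolvent A β)) :
    extResolvent A β s z
      = extResolvent A β β z + (β - s) • resolvent A s (extResolvent A β β z) := by
  refine (denseRange_toExtra _).induction_on z (isClosed_eq (by fun_prop) (by fun_prop)) ?_
  intro x
  rw [extResolvent_toExtra hβ hs, extResolvent_self_toExtra,
    (isResolventAt_resolvent hβ).identity (isResolventAt_resolvent hs)]

lemma extA_apply {A : X →ₗ.[ℂ] X} {β : ℂ} (hA : Dense (A.domain : Set X))
    (hβ : β ∈ resolventSet A) (x : A.domain) : extA A β x = toExtra _ (A x) := by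
  refine LinearMap.extendOfNorm_eq (f := toExtra (resolvent A β) ∘ₗ A.toFun)
    (e := A.domain.subtype) (by simpa [DenseRange] using hA)
    ⟨‖β‖ * ‖resolvent A β‖ + 1, fun x => ?_⟩ x
  change ‖toExtra _ (A x)‖ ≤ _ * ‖(x : X)‖
  rw [norm_toExtra, (isResolventAt_resolvent hβ).apply_map]
  refine (norm_sub_le _ _).trans ?_
  rw [norm_smul, add_mul, one_mul, mul_assoc]
  gcongr
  exact (resolvent A β).le_opNorm _

lemma extResolvent_extA {A : X →ₗ.[ℂ] X} {β : ℂ} (hA : Dense (A.domain : Set X))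
    (hβ : β ∈ resolventSet A) (x : X) :
    extResolvent A β β (extA A β x) = β • resolvent A β x - x := by
  refine hA.induction ?_ (isClosed_eq (by fun_prop) (by fun_prop)) x
  intro x hx
  rw [extA_apply hA hβ ⟨x, hx⟩, extResolvent_self_toExtra,
    (isResolventAt_resolvent hβ).apply_map]

end Extrapolation

/-- A system node `Σ(A, B, C, G)` on `(U, X, Y)`. The number `β` fixes the norms of `X₁` and `X₋₁`
and the formula for `C&D`. The output operator `C` is a linear map on `D(A)` that is bounded for
the norm `‖x‖₁ = ‖(β - A) x‖`. Only the values of `G` on the half-plane `Re s > ω(T)` are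
meaningful. -/
structure SystemNode (U X Y : Type*) [NormedAddCommGroup U] [NormedSpace ℂ U]
    [NormedAddCommGroup X] [NormedSpace ℂ X] [CompleteSpace X]
    [NormedAddCommGroup Y] [NormedSpace ℂ Y] where
  S : C0Semigroup X
  A : X →ₗ.[ℂ] X
  isGenerator : S.IsGenerator A
  β : ℂ
  β_mem : β ∈ S.halfPlane
  B : U →L[ℂ] Extra (resolvent A β)
  C : A.domain →ₗ[ℂ] Y
  C_bound : ∃ K : ℝ, ∀ x : A.domain, ‖C x‖ ≤ K * ‖β • (x : X) - A x‖
  G : ℂ → U →L[ℂ] Y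
  G_analytic : AnalyticOnNhd ℂ G S.halfPlane
  G_sub : ∀ a ∈ S.halfPlane, ∀ b ∈ S.halfPlane, ∀ u : U,
    ∃ h : extResolvent A β a (B u) - extResolvent A β b (B u) ∈ A.domain,
      G a u - G b u = C ⟨extResolvent A β a (B u) - extResolvent A β b (B u), h⟩

namespace SystemNode

variable {U X Y : Type*} [NormedAddCommGroup U] [NormedSpace ℂ U]
    [NormedAddCommGroup X] [NormedSpace ℂ X] [CompleteSpace X]
    [NormedAddCommGroup Y] [NormedSpace ℂ Y]

/-- The extrapolation space `X₋₁` of a system node. -/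
abbrev XNeg (N : SystemNode U X Y) : Type _ := Extra (resolvent N.A N.β)

/-- The embedding `X → X₋₁`. -/
abbrev emb (N : SystemNode U X Y) : X →ₗ[ℂ] N.XNeg := toExtra (resolvent N.A N.β)

lemma halfPlane_subset (N : SystemNode U X Y) {s : ℂ} (hs : s ∈ N.S.halfPlane) :
    s ∈ resolventSet N.A :=
  C0Semigroup.IsGenerator.halfPlane_subset N.isGenerator hs

lemma β_resolvent (N : SystemNode U X Y) : N.β ∈ resolventSet N.A :=
  N.halfPlane_subset N.β_mem

lemma dense_domain (N : SystemNode U X Y) : Dense (N.A.domain : Set X) :=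
  C0Semigroup.IsGenerator.dense N.isGenerator

/-- `D(C&D)`: all `(x, u)` with `A x + B u ∈ X`, where `A x + B u` is formed in `X₋₁`. -/
def cdDomain (N : SystemNode U X Y) : Submodule ℂ (X × U) where
  carrier := {p | ∃ z : X, extA N.A N.β p.1 + N.B p.2 = N.emb z}
  zero_mem' := ⟨0, by simp⟩
  add_mem' := by
    rintro p q ⟨z, hz⟩ ⟨w, hw⟩
    refine ⟨z + w, ?_⟩
    rw [map_add, ← hz, ← hw]
    simp only [Prod.fst_add, Prod.snd_add, map_add]
    abel
  smul_mem' := by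
    rintro c p ⟨z, hz⟩
    refine ⟨c • z, ?_⟩
    rw [map_smul, ← hz]
    simp

lemma sub_mem_domain (N : SystemNode U X Y) {p : X × U} (hp : p ∈ N.cdDomain) :
    p.1 - extResolvent N.A N.β N.β (N.B p.2) ∈ N.A.domain := by
  obtain ⟨z, hz⟩ := hp
  have h := congrArg (extResolvent N.A N.β N.β) hz
  rw [map_add, extResolvent_extA N.dense_domain N.β_resolvent, extResolvent_self_toExtra] at h
  have : p.1 - extResolvent N.A N.β N.β (N.B p.2) = resolvent N.A N.β (N.β • p.1 - z) := by
    rw [map_sub, map_smul, ← h]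
    abel
  rw [this]
  exact ((isResolventAt_resolvent N.β_resolvent).1 _).1

/-- The combined observation/feedthrough operator
`C&D (x, u) = C (x - R(β, A) B u) + G(β) u`. -/
def CD (N : SystemNode U X Y) : X × U →ₗ.[ℂ] Y where
  domain := N.cdDomain
  toFun :=
    { toFun := fun p => N.C ⟨p.1.1 - extResolvent N.A N.β N.β (N.B p.1.2), N.sub_mem_domain p.2⟩
        + N.G N.β p.1.2
      map_add' := fun p q => by
        have : (⟨(p + q).1.1 - extResolvent N.A N.β N.β (N.B (p + q).1.2),
            N.sub_mem_domain (p + q).2⟩ : N.A.domain)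
            = ⟨p.1.1 - extResolvent N.A N.β N.β (N.B p.1.2), N.sub_mem_domain p.2⟩
              + ⟨q.1.1 - extResolvent N.A N.β N.β (N.B q.1.2), N.sub_mem_domain q.2⟩ := by
          ext
          simp only [Submodule.coe_add, Prod.fst_add, Prod.snd_add, map_add]
          abel
        rw [this]
        simp only [Submodule.coe_add, Prod.snd_add, map_add]
        abel
      map_smul' := fun c p => by
        have : (⟨(c • p).1.1 - extResolvent N.A N.β N.β (N.B (c • p).1.2),
            N.sub_mem_domain (c • p).2⟩ : N.A.domain)
            = c • ⟨p.1.1 - extResolvent N.A N.β N.β (N.B p.1.2), N.sub_mem_domain p.2⟩ := by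
          ext
          simp [smul_sub]
        rw [this, map_smul]
        simp only [Submodule.coe_smul, Prod.smul_snd, map_smul, RingHom.id_apply, smul_add] }

/-- Classical solutions `(u, x, y)` on `[0, ∞)`. -/
structure IsClassicalSolution (N : SystemNode U X Y) (u : ℝ → U) (x : ℝ → X) (y : ℝ → Y) :
    Prop where
  continuousOn_u : ContinuousOn u (Ici 0)
  contDiffOn_x : ContDiffOn ℝ 1 x (Ici 0)
  continuousOn_y : ContinuousOn y (Ici 0)
  mem_domain : ∀ t, 0 ≤ t → (x t, u t) ∈ N.CD.domain
  state : ∀ t, 0 ≤ t → N.emb (derivWithin x (Ici 0) t) = extA N.A N.β (x t) + N.B (u t)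
  output : ∀ t (ht : 0 ≤ t), y t = N.CD ⟨(x t, u t), mem_domain t ht⟩

/-- Generalised solutions `(u, x, y)` in the distributional sense. Here `x` takes values in `X₋₁`
and `y` is a `Y`-valued distribution on `ℝ` supported in `[0, ∞)`, the second distributional
derivative of `F(t) = C&D ∫₀ᵗ (t - s) (x(s), u(s)) ds`, extended by `0` to `t < 0`. The integral
of `x` is formed in `X₋₁` and its value `K t` belongs to `X`. -/
structure IsGeneralizedSolution (N : SystemNode U X Y) (u : ℝ → U) (x : ℝ → N.XNeg)
    (y : 𝓓'((⊤ : TopologicalSpace.Opens ℝ), Y)) : Prop where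
  locallyIntegrableOn_u : LocallyIntegrableOn u (Ici 0)
  continuousOn_x : ContinuousOn x (Ici 0)
  state : ∃ x₀ : X, ∀ t, 0 ≤ t →
    x t = N.emb (N.S.T t x₀) + ∫ s in (0 : ℝ)..t, extT N.S N.A N.β (t - s) (N.B (u s))
  output : ∃ (K : ℝ → X) (F : ℝ → Y),
    (∀ t, 0 ≤ t → N.emb (K t) = ∫ s in (0 : ℝ)..t, (t - s) • x s) ∧
    (∀ t, 0 ≤ t → ((K t, ∫ s in (0 : ℝ)..t, (t - s) • u s), F t) ∈ N.CD.graph) ∧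
    LocallyIntegrableOn F (Ici 0) ∧
    ∀ φ : 𝓓((⊤ : TopologicalSpace.Opens ℝ), ℝ),
      y φ = ∫ t in Ici (0 : ℝ), iteratedDeriv 2 (fun r => φ r) t • F t

/-- `C^∞`-LILO stability. -/
def IsCinfLILOStable (N : SystemNode U X Y) : Prop :=
  ∃ c : ℝ, 0 < c ∧ ∀ (u : ℝ → U) (x : ℝ → X) (y : ℝ → Y), N.IsClassicalSolution u x y →
    ContDiff ℝ ∞ u → HasCompactSupport u → tsupport u ⊆ Ioi 0 → x 0 = 0 →
    LocallyIntegrableOn y (Ici 0) ∧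
    ∀ t, 0 < t → eLpNorm y 1 (volume.restrict (Icc 0 t))
      ≤ ENNReal.ofReal c * eLpNorm u 1 (volume.restrict (Icc 0 t))

/-- `C^∞`-BIBO stability. -/
def IsCinfBIBOStable (N : SystemNode U X Y) : Prop :=
  ∃ c : ℝ, 0 < c ∧ ∀ (u : ℝ → U) (x : ℝ → X) (y : ℝ → Y), N.IsClassicalSolution u x y →
    ContDiff ℝ ∞ u → HasCompactSupport u → tsupport u ⊆ Ioi 0 → x 0 = 0 →
    (∀ t, 0 < t → MemLp y ∞ (volume.restrict (Icc 0 t))) ∧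
    ∀ t, 0 < t → eLpNorm y ∞ (volume.restrict (Icc 0 t))
      ≤ ENNReal.ofReal c * eLpNorm u ∞ (volume.restrict (Icc 0 t))

/-- `L^∞`-BIBO stability: for every generalised solution with `u ∈ L^∞_loc` and `x(0) = 0` the
distribution `y` is a (strongly measurable) function `f ∈ L^∞_loc([0, ∞), Y)`, with the norm
bound. -/
def IsLinfBIBOStable (N : SystemNode U X Y) : Prop :=
  ∃ c : ℝ, 0 < c ∧ ∀ (u : ℝ → U) (x : ℝ → N.XNeg) (y : 𝓓'((⊤ : TopologicalSpace.Opens ℝ), Y)),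
    N.IsGeneralizedSolution u x y →
    (∀ t, 0 < t → MemLp u ∞ (volume.restrict (Icc 0 t))) → x 0 = 0 →
    ∃ f : ℝ → Y, (∀ t, 0 < t → MemLp f ∞ (volume.restrict (Icc 0 t))) ∧
      (∀ φ : 𝓓((⊤ : TopologicalSpace.Opens ℝ), ℝ), y φ = ∫ t in Ici (0 : ℝ), φ t • f t) ∧
      ∀ t, 0 < t → eLpNorm f ∞ (volume.restrict (Icc 0 t))
        ≤ ENNReal.ofReal c * eLpNorm u ∞ (volume.restrict (Icc 0 t))

end SystemNode

section Dual

/-- The dual space `E*` of all bounded conjugate-linear functionals on `E`. -/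
abbrev AntiDual (E : Type*) [NormedAddCommGroup E] [NormedSpace ℂ E] : Type _ := E →L⋆[ℂ] ℂ

variable {E F : Type*} [NormedAddCommGroup E] [NormedSpace ℂ E]
  [NormedAddCommGroup F] [NormedSpace ℂ F]

/-- The adjoint `L* φ = φ ∘ L` of a bounded operator. -/
def adj (L : E →L[ℂ] F) : AntiDual F →L[ℂ] AntiDual E :=
  LinearMap.mkContinuous
    { toFun := fun φ => φ.comp L
      map_add' := fun _ _ => rfl
      map_smul' := fun _ _ => rfl } ‖L‖ fun φ => by
        rw [mul_comm]
        exact φ.opNorm_comp_le L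

@[simp] lemma adj_apply (L : E →L[ℂ] F) (φ : AntiDual F) (x : E) : adj L φ x = φ (L x) := rfl

lemma norm_adj_le (L : E →L[ℂ] F) : ‖adj L‖ ≤ ‖L‖ :=
  LinearMap.mkContinuous_norm_le _ (norm_nonneg _) _

lemma exists_antiDual (x : E) : ∃ φ : AntiDual E, ‖φ‖ ≤ 1 ∧ φ x = ‖x‖ := by
  obtain ⟨g, h1, h2⟩ := exists_dual_vector'' ℂ x
  refine ⟨(starL ℂ : ℂ ≃L⋆[ℂ] ℂ).toContinuousLinearMap.comp g, ?_, ?_⟩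
  · refine ContinuousLinearMap.opNorm_le_bound _ zero_le_one fun y => ?_
    have : ‖g y‖ ≤ 1 * ‖y‖ := g.le_of_opNorm_le h1 y
    simpa using this
  · simp [h2]

lemma norm_le_norm_adj (L : E →L[ℂ] F) : ‖L‖ ≤ ‖adj L‖ := by
  refine ContinuousLinearMap.opNorm_le_bound _ (norm_nonneg (adj L)) fun x => ?_
  obtain ⟨φ, h1, h2⟩ := exists_antiDual (L x)
  have h3 : ‖adj L φ x‖ ≤ ‖adj L‖ * 1 * ‖x‖ :=
    (adj L φ).le_of_opNorm_le ((adj L).le_opNorm_of_le h1) x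
  simpa [h2] using h3

/-- The graph of the adjoint of an unbounded operator. -/
def adjGraph (A : E →ₗ.[ℂ] E) : Submodule ℂ (AntiDual E × AntiDual E) where
  carrier := {p | ∀ x : A.domain, p.2 x = p.1 (A x)}
  zero_mem' := fun _ => rfl
  add_mem' := fun {p q} hp hq x => by
    change p.2 x + q.2 x = p.1 (A x) + q.1 (A x)
    rw [hp x, hq x]
  smul_mem' := fun c p hp x => by
    change c • p.2 x = c • p.1 (A x)
    rw [hp x]

/-- The adjoint `A*` of a densely defined operator: `φ ∈ D(A*)` with `A* φ = ψ` if and only if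
`ψ x = φ (A x)` for all `x ∈ D(A)`. -/
def adjoint (A : E →ₗ.[ℂ] E) : AntiDual E →ₗ.[ℂ] AntiDual E := (adjGraph A).toLinearPMap

lemma mem_adjoint_graph {A : E →ₗ.[ℂ] E} (hA : Dense (A.domain : Set E)) (φ ψ : AntiDual E) :
    (φ, ψ) ∈ (adjoint A).graph ↔ ∀ x : A.domain, ψ x = φ (A x) := by
  unfold adjoint
  rw [Submodule.toLinearPMap_graph_eq]
  · rfl
  · rintro ⟨f, g⟩ h (rfl : f = 0)
    ext x
    refine hA.induction ?_ (isClosed_eq (by fun_prop) (by fun_prop)) x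
    intro x hx
    exact h ⟨x, hx⟩

lemma mem_adjoint_domain {A : E →ₗ.[ℂ] E} (hA : Dense (A.domain : Set E)) {φ ψ : AntiDual E}
    (h : ∀ x : A.domain, ψ x = φ (A x)) :
    ∃ hφ : φ ∈ (adjoint A).domain, adjoint A ⟨φ, hφ⟩ = ψ := by
  have := (mem_adjoint_graph hA φ ψ).2 h
  refine ⟨LinearPMap.mem_domain_of_mem_graph this, ?_⟩
  rw [LinearPMap.mem_graph_iff] at this
  obtain ⟨y, rfl, hy⟩ := this
  exact hy

lemma adjoint_apply {A : E →ₗ.[ℂ] E} (hA : Dense (A.domain : Set E)) (φ : (adjoint A).domain)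
    (x : A.domain) : adjoint A φ x = (φ : AntiDual E) (A x) :=
  (mem_adjoint_graph hA _ _).1 (LinearPMap.mem_graph _ φ) x

/-- `R(s̄, A*) = R(s, A)*`. -/
lemma IsResolventAt.adj {A : E →ₗ.[ℂ] E} (hA : Dense (A.domain : Set E)) {s : ℂ} {R : E →L[ℂ] E}
    (h : IsResolventAt A s R) : IsResolventAt (adjoint A) (conj s) (adj R) := by
  constructor
  · intro φ
    obtain ⟨h1, h2⟩ := mem_adjoint_domain hA (φ := LinSys.adj R φ)
      (ψ := conj s • LinSys.adj R φ - φ) (fun x => by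
        have h3 := h.2 x
        change conj s • φ (R x) - φ x = φ (R (A x))
        nth_rewrite 2 [← h3]
        simp only [map_sub, map_smulₛₗ]
        abel_nf
        simp)
    refine ⟨h1, ?_⟩
    rw [h2]
    abel
  · intro φ
    ext x
    obtain ⟨h1, h2⟩ := h.1 x
    change conj s • (φ : AntiDual E) (R x) - adjoint A φ (R x) = (φ : AntiDual E) x
    rw [adjoint_apply hA φ ⟨R x, h1⟩]
    nth_rewrite 3 [← h2]
    simp

lemma C0Semigroup.HasGen.map {S : C0Semigroup E} {x z : E} (h : S.HasGen x z) {r : ℝ}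
    (hr : 0 ≤ r) : S.HasGen (S.T r x) (S.T r z) := by
  refine (((S.T r).continuous.tendsto z).comp h).congr' ?_
  filter_upwards [self_mem_nhdsWithin] with t ht
  have ht : 0 < t := ht
  simp only [Function.comp]
  rw [ContinuousLinearMap.map_smul_of_tower, map_sub, ← ContinuousLinearMap.comp_apply,
    ← ContinuousLinearMap.comp_apply, ← S.map_add _ _ ht.le hr, ← S.map_add _ _ hr ht.le,
    add_comm]

lemma tendsto_antiDual_apply {ι : Type*} {l : Filter ι} {f : ι → AntiDual E} {g : ι → E}
    {φ : AntiDual E} {x : E} (hf : Tendsto f l (𝓝 φ)) (hg : Tendsto g l (𝓝 x)) :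
    Tendsto (fun i => f i (g i)) l (𝓝 (φ x)) := by
  have h1 : Tendsto (fun i => ‖f i - φ‖ * ‖g i‖) l (𝓝 0) := by
    simpa using (tendsto_iff_norm_sub_tendsto_zero.1 hf).mul hg.norm
  have h2 : Tendsto (fun i => (f i - φ) (g i)) l (𝓝 0) :=
    squeeze_zero_norm (fun i => (f i - φ).le_opNorm (g i)) h1
  have h3 := h2.add ((φ.continuous.tendsto x).comp hg)
  simpa using h3

lemma tendsto_orbit {ι : Type*} {l : Filter ι} [CompleteSpace E] (S : C0Semigroup E) {a r : ℝ}
    {f : ι → ℝ} {g : ι → E} {x : E} (hr : 0 ≤ r) (hf : Tendsto f l (𝓝 r))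
    (hfa : ∀ᶠ i in l, 0 ≤ f i ∧ f i ≤ a) (hg : Tendsto g l (𝓝 x)) :
    Tendsto (fun i => S.T (f i) (g i)) l (𝓝 (S.T r x)) := by
  obtain ⟨K, hK0, hK⟩ := S.exists_bound a
  have h1 : Tendsto (fun i => K * ‖g i - x‖) l (𝓝 0) := by
    simpa using (tendsto_iff_norm_sub_tendsto_zero.1 hg).const_mul K
  have h2 : Tendsto (fun i => S.T (f i) (g i - x)) l (𝓝 0) := by
    refine squeeze_zero_norm' ?_ h1
    filter_upwards [hfa] with i hi
    exact (S.T (f i)).le_of_opNorm_le (hK _ hi.1 hi.2) _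
  have h3 : Tendsto (fun i => S.T (f i) x) l (𝓝 (S.T r x)) :=
    Tendsto.comp (y := 𝓝[Ici 0] r) (S.continuousOn_orbit x r hr)
      (tendsto_nhdsWithin_iff.2 ⟨hf, hfa.mono fun _ h => h.1⟩)
  simpa using h2.add h3

/-- If `A*` generates a semigroup, then this is the adjoint semigroup. -/
lemma adj_semigroup [CompleteSpace E] {S : C0Semigroup E} {A : E →ₗ.[ℂ] E} (h : S.IsGenerator A)
    {S' : C0Semigroup (AntiDual E)} (h' : S'.IsGenerator (adjoint A)) {t : ℝ} (ht : 0 ≤ t) :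
    S'.T t = adj (S.T t) := by
  have hA := C0Semigroup.IsGenerator.dense h
  have hA' := C0Semigroup.IsGenerator.dense h'
  have key : ∀ φ ∈ (adjoint A).domain, ∀ x ∈ A.domain, S'.T t φ x = φ (S.T t x) := by
    intro φ hφ x hx
    have gx : S.HasGen x (A ⟨x, hx⟩) := (h _ _).1 (LinearPMap.mem_graph A ⟨x, hx⟩)
    have gφ : S'.HasGen φ (adjoint A ⟨φ, hφ⟩) :=
      (h' _ _).1 (LinearPMap.mem_graph (adjoint A) ⟨φ, hφ⟩)
    let f : ℝ → ℂ := fun r => S'.T r φ (S.T (t - r) x)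
    have hcont : ContinuousOn f (Icc 0 t) := by
      intro r hr
      refine tendsto_antiDual_apply
        (((S'.continuousOn_orbit φ) r hr.1).mono Icc_subset_Ici_self) ?_
      refine tendsto_orbit S (a := t) (sub_nonneg.2 hr.2) (f := fun r => t - r) ?_ ?_
        tendsto_const_nhds
      · exact (Continuous.tendsto (by fun_prop) r).mono_left nhdsWithin_le_nhds
      · filter_upwards [self_mem_nhdsWithin] with i hi
        exact ⟨sub_nonneg.2 hi.2, sub_le_self _ hi.1⟩
    have hder : ∀ r ∈ Ico 0 t, HasDerivWithinAt f 0 (Ici r) r := by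
      intro r hr
      rw [← hasDerivWithinAt_Ioi_iff_Ici, hasDerivWithinAt_iff_tendsto_slope' (by simp)]
      have hmap : Tendsto (fun s : ℝ => s - r) (𝓝[>] r) (𝓝[>] 0) := by
        refine tendsto_nhdsWithin_iff.2 ⟨?_, ?_⟩
        · have : Tendsto (fun s : ℝ => s - r) (𝓝 r) (𝓝 (r - r)) :=
            Continuous.tendsto (by fun_prop) r
          rw [sub_self] at this
          exact this.mono_left nhdsWithin_le_nhds
        · filter_upwards [self_mem_nhdsWithin] with s hs
          exact sub_pos.2 (mem_Ioi.1 hs)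
      have hev : ∀ᶠ s in 𝓝[>] r, r < s ∧ s < t := Ioo_mem_nhdsGT hr.2
      have htr : Tendsto (fun s : ℝ => t - s) (𝓝[>] r) (𝓝 (t - r)) :=
        (Continuous.tendsto (by fun_prop) r).mono_left nhdsWithin_le_nhds
      have hb : ∀ᶠ s in 𝓝[>] r, 0 ≤ t - s ∧ t - s ≤ t := by
        filter_upwards [hev] with s hs
        exact ⟨by linarith [hs.2], by linarith [hr.1, hs.1]⟩
      have l1 : Tendsto (fun s : ℝ => S.T (t - s) x) (𝓝[>] r) (𝓝 (S.T (t - r) x)) :=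
        tendsto_orbit S (sub_nonneg.2 hr.2.le) htr hb tendsto_const_nhds
      have l2 := tendsto_antiDual_apply ((gφ.map hr.1).comp hmap) l1
      have l3 : Tendsto (fun s : ℝ => S.T (t - s) ((s - r)⁻¹ • (S.T (s - r) x - x))) (𝓝[>] r)
          (𝓝 (S.T (t - r) (A ⟨x, hx⟩))) :=
        tendsto_orbit S (sub_nonneg.2 hr.2.le) htr hb (gx.comp hmap)
      have l4 := ((S'.T r φ).continuous.tendsto _).comp l3
      have l5 := l2.sub l4
      have e : S'.T r (adjoint A ⟨φ, hφ⟩) (S.T (t - r) x) - S'.T r φ (S.T (t - r) (A ⟨x, hx⟩))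
          = 0 := by
        have a1 := (h _ _).2 (gx.map (sub_nonneg.2 hr.2.le))
        have a2 := (h' _ _).2 (gφ.map hr.1)
        rw [mem_adjoint_graph hA] at a2
        rw [LinearPMap.mem_graph_iff] at a1
        obtain ⟨y, hy1, hy2⟩ := a1
        simp only at hy1 hy2
        rw [← hy1, ← hy2, a2 y, sub_self]
      rw [e] at l5
      refine l5.congr' ?_
      filter_upwards [hev] with s hs
      have p1 : 0 ≤ s - r := sub_nonneg.2 hs.1.le
      have p2 : 0 ≤ t - s := sub_nonneg.2 hs.2.le
      have q1 : S'.T s φ = S'.T (s - r) (S'.T r φ) := by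
        rw [← ContinuousLinearMap.comp_apply, ← S'.map_add _ _ p1 hr.1, sub_add_cancel]
      have q2 : S.T (t - r) x = S.T (t - s) (S.T (s - r) x) := by
        rw [← ContinuousLinearMap.comp_apply, ← S.map_add _ _ p2 p1, sub_add_sub_cancel]
      simp only [Function.comp, slope, vsub_eq_sub, f]
      rw [ContinuousLinearMap.map_smul_of_tower,
        map_real_smul (S'.T r φ) (S'.T r φ).continuous, map_sub (S.T (t - s)), ← q2, map_sub, q1]
      change (s - r)⁻¹ • (S'.T (s - r) (S'.T r φ) (S.T (t - s) x) - S'.T r φ (S.T (t - s) x)) - _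
        = _
      rw [← smul_sub]
      congr 1
      abel
    have := constant_of_has_deriv_right_zero hcont hder t ⟨ht, le_rfl⟩
    simpa [f, S.map_zero, S'.map_zero] using this
  ext φ x
  have k1 : ∀ φ ∈ (adjoint A).domain, S'.T t φ = adj (S.T t) φ := by
    intro φ hφ
    ext x
    exact hA.induction (P := fun x => S'.T t φ x = adj (S.T t) φ x) (fun x hx => key φ hφ x hx)
      (isClosed_eq (by fun_prop) (by fun_prop)) x
  have k2 : S'.T t φ = adj (S.T t) φ :=
    hA'.induction (P := fun φ => S'.T t φ = adj (S.T t) φ) (fun φ hφ => k1 φ hφ)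
      (isClosed_eq (by fun_prop) (by fun_prop)) φ
  rw [k2]

lemma adj_growthBound [CompleteSpace E] {S : C0Semigroup E} {A : E →ₗ.[ℂ] E}
    (h : S.IsGenerator A) {S' : C0Semigroup (AntiDual E)} (h' : S'.IsGenerator (adjoint A)) :
    S'.growthBound = S.growthBound := by
  unfold C0Semigroup.growthBound
  congr 1
  ext w
  refine exists_congr fun a => and_congr_right fun _ => exists_congr fun M =>
    forall₂_congr fun t ht => ?_
  rw [adj_semigroup h h' ht, le_antisymm (norm_adj_le (S.T t)) (norm_le_norm_adj (S.T t))]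

lemma conj_mem_halfPlane [CompleteSpace E] {S : C0Semigroup E} {A : E →ₗ.[ℂ] E}
    (h : S.IsGenerator A) {S' : C0Semigroup (AntiDual E)} (h' : S'.IsGenerator (adjoint A))
    {s : ℂ} : conj s ∈ S.halfPlane ↔ s ∈ S'.halfPlane := by
  simp [C0Semigroup.halfPlane, adj_growthBound h h']

end Dual

namespace SystemNode

variable {U X Y : Type*} [NormedAddCommGroup U] [NormedSpace ℂ U]
    [NormedAddCommGroup X] [NormedSpace ℂ X] [CompleteSpace X]
    [NormedAddCommGroup Y] [NormedSpace ℂ Y]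

set_option linter.unusedSectionVars false

/-- The bounded operator `C R(s, A) : X → Y`. -/
lemma exists_outRes (N : SystemNode U X Y) {s : ℂ} (hs : s ∈ resolventSet N.A) :
    ∃ L : X →L[ℂ] Y, ∀ (x : X) (h : resolvent N.A s x ∈ N.A.domain),
      L x = N.C ⟨resolvent N.A s x, h⟩ := by
  have hR := isResolventAt_resolvent hs
  obtain ⟨K, hK⟩ := N.C_bound
  let L : X →ₗ[ℂ] Y :=
    N.C ∘ₗ (resolvent N.A s).toLinearMap.codRestrict N.A.domain (fun x => (hR.1 x).1)
  refine ⟨L.mkContinuousOfExistsBound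
    ⟨|K| * (‖N.β - s‖ * ‖resolvent N.A s‖ + 1), fun x => ?_⟩, fun x h => rfl⟩
  obtain ⟨h1, h2⟩ := hR.1 x
  have h3 : N.β • resolvent N.A s x - N.A ⟨resolvent N.A s x, h1⟩
      = (N.β - s) • resolvent N.A s x + x := by
    nth_rewrite 4 [← h2]
    rw [sub_smul]
    abel
  have h4 := hK ⟨resolvent N.A s x, h1⟩
  change ‖N.C ⟨resolvent N.A s x, h1⟩‖ ≤ _
  refine h4.trans ?_
  change K * ‖N.β • resolvent N.A s x - N.A ⟨resolvent N.A s x, h1⟩‖ ≤ _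
  rw [h3, mul_assoc]
  refine mul_le_mul (le_abs_self K) ?_ (norm_nonneg _) (abs_nonneg K)
  refine (norm_add_le _ _).trans ?_
  rw [norm_smul, add_mul, one_mul, mul_assoc]
  gcongr
  exact (resolvent N.A s).le_opNorm _

/-- The bounded operator `C R(s, A) : X → Y`. -/
def outRes (N : SystemNode U X Y) {s : ℂ} (hs : s ∈ resolventSet N.A) : X →L[ℂ] Y :=
  (N.exists_outRes hs).choose

lemma outRes_apply (N : SystemNode U X Y) {s : ℂ} (hs : s ∈ resolventSet N.A) (x : X)
    (h : resolvent N.A s x ∈ N.A.domain) : N.outRes hs x = N.C ⟨resolvent N.A s x, h⟩ :=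
  (N.exists_outRes hs).choose_spec x h

lemma isResolventAt_adj (N : SystemNode U X Y) {s : ℂ} (hs : s ∈ resolventSet N.A) :
    IsResolventAt (adjoint N.A) (conj s) (adj (resolvent N.A s)) :=
  (isResolventAt_resolvent hs).adj N.dense_domain

lemma resolvent_adjoint (N : SystemNode U X Y) {s : ℂ} (hs : s ∈ resolventSet N.A) :
    resolvent (adjoint N.A) (conj s) = adj (resolvent N.A s) :=
  (N.isResolventAt_adj hs).resolvent_eq

/-- The isometric isomorphism `R(β̄, A*) : (X*)₋₁ → X*`. -/
def dualResEquiv (N : SystemNode U X Y) (hA : GeneratesC0 (adjoint N.A)) :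
    Extra (resolvent (adjoint N.A) (conj N.β)) ≃ₗᵢ[ℂ] AntiDual X :=
  LinearIsometryEquiv.ofSurjective
    { toLinearMap := (extResolvent (adjoint N.A) (conj N.β) (conj N.β)).toLinearMap
      norm_map' := norm_extResolvent_self _ _ }
    (by
      let J : Extra (resolvent (adjoint N.A) (conj N.β)) →ₗᵢ[ℂ] AntiDual X :=
        { toLinearMap := (extResolvent (adjoint N.A) (conj N.β) (conj N.β)).toLinearMap
          norm_map' := norm_extResolvent_self _ _ }
      change Function.Surjective J
      have hc : IsClosed (range J) := J.isometry.isClosedEmbedding.isClosed_range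
      have hsub : ((adjoint N.A).domain : Set (AntiDual X)) ⊆ range J := by
        intro φ hφ
        have hR := N.isResolventAt_adj N.β_resolvent
        refine ⟨toExtra _ (conj N.β • φ - adjoint N.A ⟨φ, hφ⟩), ?_⟩
        change extResolvent _ _ _ (toExtra _ _) = _
        rw [extResolvent_self_toExtra, hR.resolvent_eq]
        exact hR.2 ⟨φ, hφ⟩
      obtain ⟨S, hS⟩ := hA
      have hd := (C0Semigroup.IsGenerator.dense hS).mono hsub
      intro φ
      have := hd φ
      rwa [hc.closure_eq] at this)

lemma extResolvent_dualResEquiv_symm (N : SystemNode U X Y) (hA : GeneratesC0 (adjoint N.A))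
    (φ : AntiDual X) :
    extResolvent (adjoint N.A) (conj N.β) (conj N.β) ((N.dualResEquiv hA).symm φ) = φ :=
  (N.dualResEquiv hA).apply_symm_apply φ

/-- The duality pairing between `(X*)₋₁` and `X₁ = D(A)`, the continuous extension of
`(φ, x) ↦ φ x` from `φ ∈ X*` to `φ ∈ (X*)₋₁`. -/
def pairingLeft (N : SystemNode U X Y) (ξ : Extra (resolvent (adjoint N.A) (conj N.β)))
    (x : N.A.domain) : ℂ :=
  extResolvent (adjoint N.A) (conj N.β) (conj N.β) ξ (N.β • (x : X) - N.A x)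

lemma pairingLeft_toExtra (N : SystemNode U X Y) (φ : AntiDual X) (x : N.A.domain) :
    N.pairingLeft (toExtra _ φ) x = φ x := by
  unfold pairingLeft
  rw [extResolvent_self_toExtra, N.resolvent_adjoint N.β_resolvent, adj_apply,
    (isResolventAt_resolvent N.β_resolvent).2]

/-- The duality pairing between `D(A*)` and `X₋₁`, the continuous extension of `(φ, z) ↦ φ z` from
`z ∈ X` to `z ∈ X₋₁`. -/
def pairingRight (N : SystemNode U X Y) (φ : (adjoint N.A).domain) (z : N.XNeg) : ℂ :=
  (conj N.β • (φ : AntiDual X) - adjoint N.A φ) (extResolvent N.A N.β N.β z)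

lemma pairingRight_toExtra (N : SystemNode U X Y) (φ : (adjoint N.A).domain) (x : X) :
    N.pairingRight φ (N.emb x) = (φ : AntiDual X) x := by
  unfold pairingRight
  rw [extResolvent_self_toExtra, ← adj_apply, (N.isResolventAt_adj N.β_resolvent).2]

/-- The adjoint `C* : Y* → (X*)₋₁` of `C : X₁ → Y`. -/
def dualB (N : SystemNode U X Y) (hA : GeneratesC0 (adjoint N.A)) :
    AntiDual Y →L[ℂ] Extra (resolvent (adjoint N.A) (conj N.β)) :=
  (N.dualResEquiv hA).symm.toContinuousLinearEquiv.toContinuousLinearMap.comp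
    (adj (N.outRes N.β_resolvent))

lemma extResolvent_dualB (N : SystemNode U X Y) (hA : GeneratesC0 (adjoint N.A))
    (η : AntiDual Y) : extResolvent (adjoint N.A) (conj N.β) (conj N.β) (N.dualB hA η)
      = adj (N.outRes N.β_resolvent) η :=
  N.extResolvent_dualResEquiv_symm hA _

/-- `⟨C* η, x⟩ = η (C x)`. -/
lemma pairingLeft_dualB (N : SystemNode U X Y) (hA : GeneratesC0 (adjoint N.A)) (η : AntiDual Y)
    (x : N.A.domain) : N.pairingLeft (N.dualB hA η) x = η (N.C x) := by
  have h := (isResolventAt_resolvent N.β_resolvent).2 x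
  unfold pairingLeft
  rw [extResolvent_dualB, adj_apply, N.outRes_apply N.β_resolvent _ (by rw [h]; exact x.2)]
  congr 2
  exact Subtype.ext h

/-- The adjoint `B* : D(A*) → U*` of `B : U → X₋₁`. -/
def dualC (N : SystemNode U X Y) : (adjoint N.A).domain →ₗ[ℂ] AntiDual U :=
  (adj ((extResolvent N.A N.β N.β).comp N.B)).toLinearMap ∘ₗ
    (conj N.β • (adjoint N.A).domain.subtype - (adjoint N.A).toFun)

/-- `(B* φ) u = ⟨φ, B u⟩`. -/
lemma dualC_apply (N : SystemNode U X Y) (φ : (adjoint N.A).domain) (u : U) :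
    N.dualC φ u = N.pairingRight φ (N.B u) := rfl

lemma isOpen_halfPlane (S : C0Semigroup X) : IsOpen S.halfPlane :=
  isOpen_Ioi.preimage (continuous_coe_real_ereal.comp Complex.continuous_re)

lemma dual_analytic (N : SystemNode U X Y) {S' : C0Semigroup (AntiDual X)}
    (h' : S'.IsGenerator (adjoint N.A)) :
    AnalyticOnNhd ℂ (fun s => adj (N.G (conj s))) S'.halfPlane := by
  refine DifferentiableOn.analyticOnNhd (fun s hs => ?_) (isOpen_halfPlane S')
  have hs' := (conj_mem_halfPlane N.isGenerator h').2 hs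
  have hd := (N.G_analytic _ hs').differentiableAt.hasDerivAt
  refine DifferentiableAt.differentiableWithinAt
    (HasDerivAt.differentiableAt (f' := adj (deriv N.G (conj s))) ?_)
  rw [hasDerivAt_iff_tendsto] at hd ⊢
  have hcj : Tendsto (fun w : ℂ => conj w) (𝓝 s) (𝓝 (conj s)) := Complex.continuous_conj.tendsto s
  refine squeeze_zero (fun w => by positivity) (fun w => ?_) (hd.comp hcj)
  simp only [Function.comp]
  rw [← map_sub, RCLike.norm_conj]
  gcongr
  refine le_trans (le_of_eq ?_) (norm_adj_le _)
  congr 1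
  ext η u
  simp [map_sub]

lemma outRes_map (N : SystemNode U X Y) {s : ℂ} (hs : s ∈ resolventSet N.A) (x : N.A.domain) :
    N.outRes hs (N.A x) = s • N.outRes hs x - N.C x := by
  have hR := isResolventAt_resolvent hs
  have e : N.A x = s • (x : X) - (s • (x : X) - N.A x) := by abel
  have h2 := hR.2 x
  have h3 : N.outRes hs (s • (x : X) - N.A x) = N.C x := by
    rw [N.outRes_apply hs _ (by rw [h2]; exact x.2)]
    congr 1
    exact Subtype.ext h2
  rw [e, map_sub, map_smul, h3]

lemma extResolvent_dualB_of (N : SystemNode U X Y) (hA : GeneratesC0 (adjoint N.A)) {a : ℂ}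
    (ha : conj a ∈ resolventSet N.A) (η : AntiDual Y) :
    extResolvent (adjoint N.A) (conj N.β) a (N.dualB hA η) = adj (N.outRes ha) η := by
  have r1 : conj N.β ∈ resolventSet (adjoint N.A) := ⟨_, N.isResolventAt_adj N.β_resolvent⟩
  have r2 : a ∈ resolventSet (adjoint N.A) :=
    ⟨adj (resolvent N.A (conj a)), by simpa using N.isResolventAt_adj ha⟩
  have r3 : resolvent (adjoint N.A) a = adj (resolvent N.A (conj a)) := by
    simpa using N.resolvent_adjoint ha
  rw [extResolvent_apply r1 r2, extResolvent_dualB, r3]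
  ext x
  obtain ⟨m1, -⟩ := (isResolventAt_resolvent ha).1 x
  obtain ⟨m2, -⟩ := (isResolventAt_resolvent N.β_resolvent).1 x
  obtain ⟨m3, -⟩ := (isResolventAt_resolvent N.β_resolvent).1 (resolvent N.A (conj a) x)
  have id := (isResolventAt_resolvent ha).identity (isResolventAt_resolvent N.β_resolvent) x
  have e : (⟨resolvent N.A N.β x, m2⟩ : N.A.domain) = ⟨resolvent N.A (conj a) x, m1⟩
      + (conj a - N.β) • ⟨resolvent N.A N.β (resolvent N.A (conj a) x), m3⟩ := Subtype.ext id
  have e2 : N.outRes N.β_resolvent x = N.outRes ha x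
      + (conj a - N.β) • N.outRes N.β_resolvent (resolvent N.A (conj a) x) := by
    rw [N.outRes_apply _ _ m2, N.outRes_apply _ _ m1, N.outRes_apply _ _ m3, e, map_add, map_smul]
  change η (N.outRes N.β_resolvent x)
    + (conj N.β - a) • η (N.outRes N.β_resolvent (resolvent N.A (conj a) x)) = η (N.outRes ha x)
  rw [e2]
  simp only [map_add, map_smulₛₗ, map_sub, Complex.conj_conj, smul_eq_mul]
  ring

lemma dual_G_sub (N : SystemNode U X Y) (hA : GeneratesC0 (adjoint N.A))
    {S' : C0Semigroup (AntiDual X)} (h' : S'.IsGenerator (adjoint N.A)) :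
    ∀ a ∈ S'.halfPlane, ∀ b ∈ S'.halfPlane, ∀ η : AntiDual Y,
    ∃ h : extResolvent (adjoint N.A) (conj N.β) a (N.dualB hA η)
        - extResolvent (adjoint N.A) (conj N.β) b (N.dualB hA η) ∈ (adjoint N.A).domain,
      adj (N.G (conj a)) η - adj (N.G (conj b)) η
        = N.dualC ⟨extResolvent (adjoint N.A) (conj N.β) a (N.dualB hA η)
          - extResolvent (adjoint N.A) (conj N.β) b (N.dualB hA η), h⟩ := by
  intro a ha b hb η
  have ha' := (conj_mem_halfPlane N.isGenerator h').2 ha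
  have hb' := (conj_mem_halfPlane N.isGenerator h').2 hb
  have hra := N.halfPlane_subset ha'
  have hrb := N.halfPlane_subset hb'
  rw [N.extResolvent_dualB_of hA hra, N.extResolvent_dualB_of hA hrb]
  obtain ⟨h1, h2⟩ := mem_adjoint_domain N.dense_domain
    (φ := adj (N.outRes hra) η - adj (N.outRes hrb) η)
    (ψ := a • adj (N.outRes hra) η - b • adj (N.outRes hrb) η) (fun x => by
      change a • η (N.outRes hra x) - b • η (N.outRes hrb x)
        = η (N.outRes hra (N.A x)) - η (N.outRes hrb (N.A x))
      rw [N.outRes_map hra, N.outRes_map hrb]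
      simp)
  refine ⟨h1, ?_⟩
  ext u
  obtain ⟨h3, h4⟩ := N.G_sub _ ha' _ hb' u
  rw [dualC_apply]
  unfold pairingRight
  rw [h2]
  set w := extResolvent N.A N.β N.β (N.B u) with hw
  obtain ⟨ma, -⟩ := (isResolventAt_resolvent hra).1 w
  obtain ⟨mb, -⟩ := (isResolventAt_resolvent hrb).1 w
  have h5 : (⟨_, h3⟩ : N.A.domain) = (N.β - conj a) • ⟨resolvent N.A (conj a) w, ma⟩
      - (N.β - conj b) • ⟨resolvent N.A (conj b) w, mb⟩ := by
    ext
    change extResolvent N.A N.β (conj a) (N.B u) - extResolvent N.A N.β (conj b) (N.B u)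
      = (N.β - conj a) • resolvent N.A (conj a) w - (N.β - conj b) • resolvent N.A (conj b) w
    rw [extResolvent_apply N.β_resolvent hra, extResolvent_apply N.β_resolvent hrb, ← hw]
    abel
  rw [h5, map_sub, map_smul, map_smul, ← N.outRes_apply hra w ma, ← N.outRes_apply hrb w mb] at h4
  change η (N.G (conj a) u) - η (N.G (conj b) u)
    = conj N.β • (η (N.outRes hra w) - η (N.outRes hrb w))
      - (a • η (N.outRes hra w) - b • η (N.outRes hrb w))
  rw [← map_sub, h4]
  simp only [map_sub, map_smulₛₗ, Complex.conj_conj, smul_eq_mul]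
  ring

/-- The dual system node `Σ(A*, C*, B*, G(s̄)*)` on `(Y*, X*, U*)`. -/
def dual (N : SystemNode U X Y) (hA : GeneratesC0 (adjoint N.A)) :
    SystemNode (AntiDual Y) (AntiDual X) (AntiDual U) where
  S := hA.choose
  A := adjoint N.A
  isGenerator := hA.choose_spec
  β := conj N.β
  β_mem := (conj_mem_halfPlane N.isGenerator hA.choose_spec).1 (by simpa using N.β_mem)
  B := N.dualB hA
  C := N.dualC
  C_bound := ⟨‖adj ((extResolvent N.A N.β N.β).comp N.B)‖, fun φ =>
    (adj ((extResolvent N.A N.β N.β).comp N.B)).le_opNorm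
      (conj N.β • (φ : AntiDual X) - adjoint N.A φ)⟩
  G s := adj (N.G (conj s))
  G_analytic := N.dual_analytic hA.choose_spec
  G_sub := N.dual_G_sub hA hA.choose_spec

end SystemNode

/-- The Radon–Nikodým property of a Banach space `E`: every `E`-valued measure of bounded variation
that is absolutely continuous with respect to a finite measure `μ` has a Bochner integrable
density with respect to `μ`. -/
def HasRNP (E : Type*) [NormedAddCommGroup E] [NormedSpace ℂ E] : Prop :=
  ∀ (Ω : Type) [MeasurableSpace Ω] (μ : Measure Ω) [IsFiniteMeasure μ] (ν : VectorMeasure Ω E),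
    ν.variation univ < ⊤ → (∀ s, MeasurableSet s → μ s = 0 → ν s = 0) →
    ∃ f : Ω → E, Integrable f μ ∧ ∀ s, MeasurableSet s → ν s = ∫ r in s, f r ∂μ

end LinSys

end

/-! A LILO bound for a node and a BIBO bound for its dual are two readings of one pairing. Let `(u,
x, y)` and `(η, φ, θ)` be classical solutions of the node and of the dual node with zero initial
states. Then `t ↦ φ(t) (x(a - t))` vanishes at `0` and at `a`, and integrating its derivative gives
`∫₀ᵃ θ(t) (u(a - t)) dt = ∫₀ᵃ η(t) (y(a - t)) dt` (`integral_duality`, from the pointwise identity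
`duality`). Insert `u(t) = ρ(a - t) u₀` with a scalar test function `ρ`. By the LILO bound the right
side is at most `c · ess sup ‖η‖ · ∫₀ᵃ |ρ| · ‖u₀‖`, so `∫ ρ θ` has norm at most `c · ess sup ‖η‖ ·
∫₀ᵃ |ρ|` in `U*`. Letting `ρ` shrink to a point (`ae_norm_le_of_norm_integral_smul_le`) bounds `‖θ‖`
almost everywhere by `c · ess sup ‖η‖`; the constant of the node is kept.

For a generalised solution of the dual node with locally bounded input `η`, integrate twice. The
second primitive `η₂` is the input of a classical solution with output `θ₂`, and `y = θ₂''` as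
distributions (`IsGeneralizedSolution.exists_output`). Pair `θ₂` with the input `v''`, where `v` is
the reflected test function. Zero-state outputs commute with differentiation, so two integrations by
parts move both derivatives from the output of `v''` to `η₂`, and the LILO bound applies to `v` as
before. Hence `y` is bounded, locally in time, by the `L¹` norms of test functions. It therefore
extends to an operator from `L¹` of a bounded interval to `U*`, and the Radon–Nikodým property
represents such an operator by a density (`HasRNP.exists_density_of_clm`).

Unbounded operators are kept out of the computations: the node enters through `R(β, A)`, `R(β, A)
B`, `C R(β, A)` and `G(β)`, and zero-state solutions are given by the explicit formulas `stateOf`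
and `outputOf`, built on convolution with the semigroup. -/

noncomputable section

namespace LinSys

set_option linter.unusedSectionVars false

/-! ### Primitives of locally integrable functions on the half-line -/

section Primitive

variable {E F : Type*} [NormedAddCommGroup E] [NormedSpace ℝ E]
  [NormedAddCommGroup F] [NormedSpace ℝ F]

/-- The function `v` is the primitive on `[0, ∞)` of the locally integrable function `w`, with
`v 0 = 0`. -/
structure IsPrimitive (v w : ℝ → E) : Prop where
  intervalIntegrable : ∀ a, 0 ≤ a → IntervalIntegrable w volume 0 a
  eq_integral : ∀ t, 0 ≤ t → v t = ∫ s in (0 : ℝ)..t, w s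

lemma IsPrimitive.of_integral {w : ℝ → E}
    (h : ∀ a, 0 ≤ a → IntervalIntegrable w volume 0 a) :
    IsPrimitive (fun t => ∫ s in (0 : ℝ)..t, w s) w :=
  ⟨h, fun _ _ => rfl⟩

lemma intervalIntegrable_of_continuousOn_Ici {w : ℝ → E} (h : ContinuousOn w (Ici 0)) (a : ℝ)
    (ha : 0 ≤ a) : IntervalIntegrable w volume 0 a :=
  (h.mono (by rw [uIcc_of_le ha]; exact Icc_subset_Ici_self)).intervalIntegrable

lemma IsPrimitive.continuousOn {v w : ℝ → E} (h : IsPrimitive v w) : ContinuousOn v (Ici 0) := by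
  intro t ht
  have ht : 0 ≤ t := ht
  have h1 : ContinuousOn (fun t => ∫ s in (0 : ℝ)..t, w s) (Icc 0 (t + 1)) := by
    have := intervalIntegral.continuousOn_primitive_interval (a := 0) (b := t + 1) (μ := volume)
      (f := w) ((h.intervalIntegrable (t + 1) (by linarith)).1.congr_set_ae ?_)
    · rwa [uIcc_of_le (by linarith)] at this
    · rw [uIcc_of_le (by linarith)]
      exact Ioc_ae_eq_Icc.symm
  have h2 : ContinuousWithinAt v (Icc 0 (t + 1)) t :=
    (h1 t ⟨ht, by linarith⟩).congr (fun s hs => h.eq_integral s hs.1) (h.eq_integral t ht)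
  refine h2.mono_of_mem_nhdsWithin ?_
  exact mem_nhdsWithin.2 ⟨Iio (t + 1), isOpen_Iio, by simp, fun s hs => ⟨hs.2, hs.1.le⟩⟩

lemma IsPrimitive.hasDerivWithinAt [CompleteSpace E] {v w : ℝ → E} (h : IsPrimitive v w)
    (hw : ContinuousOn w (Ici 0)) {t : ℝ} (ht : 0 ≤ t) :
    HasDerivWithinAt v (w t) (Ici 0) t := by
  -- Extending `w` by the constant `w 0` to negative times makes it continuous on the whole line, so
  -- the two-sided fundamental theorem applies also at `t = 0`.
  let w' : ℝ → E := fun s => w (max s 0)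
  have hc : Continuous w' :=
    hw.comp_continuous (f := fun t : ℝ => max t 0) (by fun_prop) (fun _ => mem_Ici.2 (le_max_right _ _))
  have h1 := (intervalIntegral.integral_hasDerivAt_right (hc.intervalIntegrable 0 t)
      (hc.stronglyMeasurableAtFilter _ _) hc.continuousAt).hasDerivWithinAt (s := Ici 0)
  have e : ∀ s, 0 ≤ s → v s = ∫ r in (0 : ℝ)..s, w' r := fun s hs => by
    rw [h.eq_integral s hs]
    refine intervalIntegral.integral_congr fun r hr => ?_
    rw [uIcc_of_le hs] at hr
    simp [w', hr.1]
  have h2 : w' t = w t := by simp [w', ht]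
  rw [h2] at h1
  exact h1.congr (fun s hs => e s hs) (e t ht)

lemma IsPrimitive.of_hasDerivWithinAt [CompleteSpace E] {v w : ℝ → E} (h0 : v 0 = 0)
    (hd : ∀ t, 0 ≤ t → HasDerivWithinAt v (w t) (Ici 0) t)
    (hw : ContinuousOn w (Ici 0)) : IsPrimitive v w := by
  refine ⟨intervalIntegrable_of_continuousOn_Ici hw, fun t ht => ?_⟩
  rw [intervalIntegral.integral_eq_sub_of_hasDerivAt_of_le ht
    (fun s hs => ((hd s hs.1).continuousWithinAt).mono Icc_subset_Ici_self)
    (fun s hs => (hd s hs.1.le).hasDerivAt (Ici_mem_nhds hs.1))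
    (intervalIntegrable_of_continuousOn_Ici hw t ht), h0, sub_zero]

lemma IsPrimitive.map [CompleteSpace E] [CompleteSpace F] {v w : ℝ → E} (h : IsPrimitive v w)
    (L : E →L[ℝ] F) :
    IsPrimitive (fun t => L (v t)) (fun t => L (w t)) := by
  refine ⟨fun a ha => ⟨L.integrable_comp (h.intervalIntegrable a ha).1,
    L.integrable_comp (h.intervalIntegrable a ha).2⟩, fun t ht => ?_⟩
  rw [h.eq_integral t ht, L.intervalIntegral_comp_comm (h.intervalIntegrable t ht)]

lemma IsPrimitive.sub {v w v' w' : ℝ → E} (h : IsPrimitive v w) (h' : IsPrimitive v' w') :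
    IsPrimitive (fun t => v t - v' t) (fun t => w t - w' t) :=
  ⟨fun a ha => (h.intervalIntegrable a ha).sub (h'.intervalIntegrable a ha), fun t ht => by
    rw [h.eq_integral t ht, h'.eq_integral t ht, intervalIntegral.integral_sub
      (h.intervalIntegrable t ht) (h'.intervalIntegrable t ht)]⟩

lemma IsPrimitive.smul [NormedSpace ℂ E] {v w : ℝ → E} (h : IsPrimitive v w)
    (c : ℂ) : IsPrimitive (fun t => c • v t) (fun t => c • w t) :=
  ⟨fun a ha => (h.intervalIntegrable a ha).smul c, fun t ht => by
    rw [h.eq_integral t ht, intervalIntegral.integral_smul]⟩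

/-- Two orders of integration over the triangle `s + t ≤ a`. -/
lemma integral_triangle_swap {f : ℝ → ℝ → E} {a : ℝ} (ha : 0 ≤ a)
    (hf : IntegrableOn (Function.uncurry f) (Ioc 0 a ×ˢ Ioc 0 a)) :
    ∫ t in (0 : ℝ)..a, ∫ s in (0 : ℝ)..(a - t), f s t
      = ∫ s in (0 : ℝ)..a, ∫ t in (0 : ℝ)..(a - s), f s t := by
  let D : Set (ℝ × ℝ) := {p | p.1 + p.2 ≤ a}
  have hD : MeasurableSet D := measurableSet_le (by fun_prop) (by fun_prop)
  have key : ∀ (g : ℝ → E) (t : ℝ), 0 < t →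
      ∫ s in (0 : ℝ)..(a - t), g s = if t ≤ a then
        ∫ s in Ioc 0 a, (Iic (a - t)).indicator g s else ∫ s in (0 : ℝ)..(a - t), g s := by
    intro g t ht
    split_ifs with h
    · rw [intervalIntegral.integral_of_le (by linarith), setIntegral_indicator measurableSet_Iic]
      congr 2
      ext s
      simp only [mem_Ioc, mem_inter_iff, mem_Iic]
      constructor
      · rintro ⟨h1, h2⟩; exact ⟨⟨h1, by linarith⟩, h2⟩
      · rintro ⟨⟨h1, -⟩, h2⟩; exact ⟨h1, h2⟩
    · rfl
  have e1 : ∀ t ∈ Ioc (0 : ℝ) a, ∫ s in (0 : ℝ)..(a - t), f s t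
      = ∫ s in Ioc 0 a, D.indicator (Function.uncurry f) (s, t) := by
    intro t ht
    rw [key _ t ht.1, if_pos ht.2]
    congr 1
    ext s
    simp [indicator, D, le_sub_iff_add_le]
  have e2 : ∀ s ∈ Ioc (0 : ℝ) a, ∫ t in (0 : ℝ)..(a - s), f s t
      = ∫ t in Ioc 0 a, D.indicator (Function.uncurry f) (s, t) := by
    intro s hs
    rw [key _ s hs.1, if_pos hs.2]
    congr 1
    ext t
    simp [indicator, D, le_sub_iff_add_le, add_comm s t]
  rw [intervalIntegral.integral_of_le ha, intervalIntegral.integral_of_le ha,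
    setIntegral_congr_fun measurableSet_Ioc e1, setIntegral_congr_fun measurableSet_Ioc e2]
  have hI : Integrable (Function.uncurry fun s t => D.indicator (Function.uncurry f) (s, t))
      ((volume.restrict (Ioc 0 a)).prod (volume.restrict (Ioc 0 a))) := by
    rw [Measure.prod_restrict]
    exact Integrable.indicator hf hD
  exact (integral_integral_swap hI).symm

end Primitive

/-! ### Convolution with a strongly continuous semigroup -/

namespace C0Semigroup

variable {X : Type*} [NormedAddCommGroup X] [NormedSpace ℂ X] [CompleteSpace X]

/-- Strong continuity together with local boundedness of `‖T(t)‖` gives joint continuity. This is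
what makes `s ↦ T(t - s) p(s)` measurable when `p` is only strongly measurable. -/
lemma continuous_orbit_uncurry (S : C0Semigroup X) :
    Continuous fun q : X × ℝ => S.orbit q.1 q.2 := by
  rw [continuous_iff_continuousAt]
  rintro ⟨x, t⟩
  refine tendsto_orbit S (a := max t 0 + 1) (le_max_right _ _)
    (f := fun q : X × ℝ => max q.2 0) ?_ ?_ continuous_fst.continuousAt
  · exact Continuous.tendsto (f := fun q : X × ℝ => max q.2 0) (by fun_prop) (x, t)
  · have : ∀ᶠ q : X × ℝ in 𝓝 (x, t), max q.2 0 < max t 0 + 1 :=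
      (Continuous.tendsto (f := fun q : X × ℝ => max q.2 0) (by fun_prop) (x, t)).eventually_lt_const
        (lt_add_one _)
    exact this.mono fun q hq => ⟨le_max_right _ _, hq.le⟩

/-- Orbits are constant at negative times, so an upper bound on time is enough. -/
lemma exists_norm_orbit_le (S : C0Semigroup X) (a : ℝ) :
    ∃ K, 0 ≤ K ∧ ∀ x t, t ≤ a → ‖S.orbit x t‖ ≤ K * ‖x‖ := by
  obtain ⟨K, hK0, hK⟩ := S.exists_bound (max a 0)
  exact ⟨K, hK0, fun x t ht => (S.T _).le_of_opNorm_le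
    (hK _ (le_max_right _ _) (max_le_max_right 0 ht)) x⟩

lemma orbit_sub (S : C0Semigroup X) (x y : X) (t : ℝ) :
    S.orbit (x - y) t = S.orbit x t - S.orbit y t := map_sub _ _ _

lemma orbit_smul (S : C0Semigroup X) (c : ℂ) (x : X) (t : ℝ) :
    S.orbit (c • x) t = c • S.orbit x t := map_smul _ _ _

lemma orbit_zero (S : C0Semigroup X) (x : X) : S.orbit x 0 = x := by
  rw [S.orbit_of_nonneg x le_rfl, S.map_zero]
  rfl

/-- The convolution `t ↦ ∫₀ᵗ T(t - s) p(s) ds`. -/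
def conv (S : C0Semigroup X) (p : ℝ → X) (t : ℝ) : X :=
  ∫ s in (0 : ℝ)..t, S.orbit (p s) (t - s)

lemma intervalIntegrable_orbit (S : C0Semigroup X) {p : ℝ → X} {a : ℝ} {g : ℝ → ℝ} {b : ℝ}
    (hg : Continuous g) (hb : ∀ s ∈ Ioc 0 a, g s ≤ b)
    (ha : 0 ≤ a) (hp : IntervalIntegrable p volume 0 a) :
    IntervalIntegrable (fun s => S.orbit (p s) (g s)) volume 0 a := by
  obtain ⟨K, hK0, hK⟩ := S.exists_norm_orbit_le b
  rw [intervalIntegrable_iff_integrableOn_Ioc_of_le ha] at hp ⊢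
  refine Integrable.mono' (hp.norm.const_mul K) ?_ ?_
  · exact S.continuous_orbit_uncurry.comp_aestronglyMeasurable
      (hp.aestronglyMeasurable.prodMk hg.aestronglyMeasurable)
  · filter_upwards [ae_restrict_mem measurableSet_Ioc] with s hs
    exact hK _ _ (hb s hs)

lemma integrableOn_orbit_prod (S : C0Semigroup X) {p : ℝ → X} {a : ℝ} {g : ℝ × ℝ → ℝ} {b : ℝ}
    (hg : Continuous g) (hb : ∀ z ∈ Ioc 0 a ×ˢ Ioc 0 a, g z ≤ b)
    (ha : 0 ≤ a) (hp : IntervalIntegrable p volume 0 a) :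
    IntegrableOn (fun z : ℝ × ℝ => S.orbit (p z.1) (g z)) (Ioc 0 a ×ˢ Ioc 0 a) := by
  obtain ⟨K, hK0, hK⟩ := S.exists_norm_orbit_le b
  rw [intervalIntegrable_iff_integrableOn_Ioc_of_le ha] at hp
  have h1 : Integrable (fun z : ℝ × ℝ => p z.1)
      ((volume.restrict (Ioc 0 a)).prod (volume.restrict (Ioc 0 a))) := hp.comp_fst _
  have h2 : Integrable (fun z : ℝ × ℝ => p z.1)
      ((volume : Measure (ℝ × ℝ)).restrict (Ioc 0 a ×ˢ Ioc 0 a)) := by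
    rwa [Measure.prod_restrict] at h1
  refine Integrable.mono' (h2.norm.const_mul K) ?_ ?_
  · exact S.continuous_orbit_uncurry.comp_aestronglyMeasurable
      (h2.aestronglyMeasurable.prodMk hg.aestronglyMeasurable)
  · filter_upwards [ae_restrict_mem (measurableSet_Ioc.prod measurableSet_Ioc)] with z hz
    exact hK _ _ (hb z hz)

lemma intervalIntegrable_conv (S : C0Semigroup X) {p : ℝ → X} {t : ℝ} (ht : 0 ≤ t)
    (hp : IntervalIntegrable p volume 0 t) :
    IntervalIntegrable (fun s => S.orbit (p s) (t - s)) volume 0 t :=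
  S.intervalIntegrable_orbit (b := t) (by fun_prop) (fun s hs => by linarith [hs.1]) ht hp

lemma conv_sub (S : C0Semigroup X) {p q : ℝ → X} {t : ℝ} (ht : 0 ≤ t)
    (hp : IntervalIntegrable p volume 0 t) (hq : IntervalIntegrable q volume 0 t) :
    S.conv (fun s => p s - q s) t = S.conv p t - S.conv q t := by
  unfold conv
  rw [← intervalIntegral.integral_sub (S.intervalIntegrable_conv ht hp)
    (S.intervalIntegrable_conv ht hq)]
  simp only [orbit_sub]

lemma conv_smul (S : C0Semigroup X) (p : ℝ → X) (c : ℂ) (t : ℝ) :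
    S.conv (fun s => c • p s) t = c • S.conv p t := by
  unfold conv
  simp only [orbit_smul]
  exact intervalIntegral.integral_smul c _

lemma conv_zero (S : C0Semigroup X) (p : ℝ → X) : S.conv p 0 = 0 := by simp [conv]

/-- Dominated convergence on a fixed interval: the moving endpoint `r` becomes the indicator of `s ≤
r`, the majorant is `K ‖p s‖`, and the integrand is continuous in `r` at `t` for every `s ≠ t`, that
is, outside a null set. -/
lemma continuousOn_conv (S : C0Semigroup X) {p : ℝ → X}
    (hp : ∀ a, 0 ≤ a → IntervalIntegrable p volume 0 a) : ContinuousOn (S.conv p) (Ici 0) := by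
  intro t ht
  have ht : 0 ≤ t := ht
  obtain ⟨K, hK0, hK⟩ := S.exists_norm_orbit_le (t + 1)
  have hI := hp (t + 1) (by linarith)
  rw [intervalIntegrable_iff_integrableOn_Ioc_of_le (by linarith)] at hI
  have e : ∀ r, 0 ≤ r → r < t + 1 → S.conv p r
      = ∫ s in Ioc 0 (t + 1), (Iic r).indicator (fun s => S.orbit (p s) (r - s)) s := by
    intro r hr hrt
    rw [conv, intervalIntegral.integral_of_le hr, setIntegral_indicator measurableSet_Iic]
    congr 2
    ext s
    simp only [mem_Ioc, mem_inter_iff, mem_Iic]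
    constructor
    · rintro ⟨h1, h2⟩; exact ⟨⟨h1, by linarith⟩, h2⟩
    · rintro ⟨⟨h1, -⟩, h2⟩; exact ⟨h1, h2⟩
  have hev : ∀ᶠ r in 𝓝[Ici 0] t, 0 ≤ r ∧ r < t + 1 := by
    filter_upwards [self_mem_nhdsWithin,
      mem_nhdsWithin_of_mem_nhds (Iio_mem_nhds (lt_add_one t))] with r h1 h2
    exact ⟨h1, h2⟩
  have hcont : ContinuousWithinAt (fun r => ∫ s in Ioc 0 (t + 1),
      (Iic r).indicator (fun s => S.orbit (p s) (r - s)) s) (Ici 0) t := by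
    refine continuousWithinAt_of_dominated (bound := fun s => K * ‖p s‖) ?_ ?_
      (hI.norm.const_mul K) ?_
    · refine Eventually.of_forall fun r => ?_
      refine AEStronglyMeasurable.indicator ?_ measurableSet_Iic
      exact S.continuous_orbit_uncurry.comp_aestronglyMeasurable
        (hI.aestronglyMeasurable.prodMk
          (Continuous.aestronglyMeasurable (f := fun s => r - s) (by fun_prop)))
    · filter_upwards [hev] with r hr
      filter_upwards [ae_restrict_mem measurableSet_Ioc] with s hs
      refine (norm_indicator_le_norm_self _ _).trans (hK _ _ ?_)
      linarith [hs.1, hr.2]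
    · have hne : ∀ᵐ s ∂(volume.restrict (Ioc 0 (t + 1))), s ≠ t :=
        ae_restrict_of_ae (Measure.ae_ne volume t)
      filter_upwards [hne] with s hs
      refine ContinuousAt.continuousWithinAt ?_
      rcases lt_or_gt_of_ne hs with h | h
      · have : (fun r => (Iic r).indicator (fun s => S.orbit (p s) (r - s)) s)
            =ᶠ[𝓝 t] fun r => S.orbit (p s) (r - s) := by
          filter_upwards [Ioi_mem_nhds h] with r hr
          exact indicator_of_mem (mem_Iic.2 (le_of_lt hr)) _
        refine ContinuousAt.congr ?_ this.symm
        exact ((S.continuous_orbit (p s)).comp (continuous_id.sub continuous_const)).continuousAt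
      · have : (fun r => (Iic r).indicator (fun s => S.orbit (p s) (r - s)) s)
            =ᶠ[𝓝 t] fun r => 0 := by
          filter_upwards [Iio_mem_nhds h] with r hr
          exact indicator_of_notMem (by simpa using hr) _
        exact continuousAt_const.congr this.symm
  refine hcont.congr_of_eventuallyEq ?_ (e t ht (lt_add_one t))
  filter_upwards [hev] with r hr
  exact e r hr.1 hr.2

/-- Convolution with the semigroup commutes with taking primitives. -/
lemma isPrimitive_conv (S : C0Semigroup X) {p₁ p : ℝ → X} (h : IsPrimitive p₁ p) :
    IsPrimitive (S.conv p₁) (S.conv p) := by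
  refine ⟨intervalIntegrable_of_continuousOn_Ici (S.continuousOn_conv h.intervalIntegrable),
    fun t ht => ?_⟩
  have hI := h.intervalIntegrable t ht
  -- Both sides are the integral of `T(s) p(r)` over the triangle `r + s ≤ t`. Here `p₁(t - s)` is
  -- written as an integral of `p` and the order of integration is exchanged; `p` need not be
  -- continuous.
  have e1 : S.conv p₁ t = ∫ r in (0 : ℝ)..t, ∫ s in (0 : ℝ)..(t - r), S.orbit (p r) s := by
    have s1 : S.conv p₁ t = ∫ s in (0 : ℝ)..t, S.orbit (p₁ (t - s)) s := by
      have := intervalIntegral.integral_comp_sub_left (a := 0) (b := t)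
        (fun s => S.orbit (p₁ s) (t - s)) t
      simpa [conv] using this.symm
    rw [s1, ← integral_triangle_swap (f := fun r s => S.orbit (p r) s) ht
      (S.integrableOn_orbit_prod (g := fun z => z.2) (b := t) (by fun_prop)
        (fun z hz => hz.2.2) ht hI)]
    refine intervalIntegral.integral_congr fun s hs => ?_
    rw [uIcc_of_le ht] at hs
    have hs' : 0 ≤ t - s := by linarith [hs.2]
    rw [h.eq_integral _ hs']
    exact (ContinuousLinearMap.intervalIntegral_comp_comm (S.T (max s 0))
      (h.intervalIntegrable _ hs')).symm
  have e2 : ∫ r in (0 : ℝ)..t, S.conv p r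
      = ∫ r in (0 : ℝ)..t, ∫ s in (0 : ℝ)..(t - r), S.orbit (p r) s := by
    have s1 : ∫ r in (0 : ℝ)..t, S.conv p r = ∫ r in (0 : ℝ)..t, S.conv p (t - r) := by
      simp [intervalIntegral.integral_comp_sub_left (S.conv p) t]
    rw [s1]
    unfold conv
    rw [integral_triangle_swap (f := fun s r => S.orbit (p s) (t - r - s)) ht
      (S.integrableOn_orbit_prod (g := fun z => t - z.2 - z.1) (b := t) (by fun_prop)
        (fun z hz => by linarith [hz.1.1, hz.2.1]) ht hI)]
    refine intervalIntegral.integral_congr fun r hr => ?_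
    have := intervalIntegral.integral_comp_sub_left (a := 0) (b := t - r)
        (fun s => S.orbit (p r) s) (t - r)
    simp only [sub_self, sub_zero] at this
    rw [← this]
    congr 1
    ext s
    congr 1
    ring
  rw [e1, e2]

/-- If `p₁` is a primitive of `p`, then `T * p₁` takes values in the domain of the generator. -/
lemma hasGen_conv (S : C0Semigroup X) {p₁ p : ℝ → X} (h : IsPrimitive p₁ p) {t : ℝ}
    (ht : 0 ≤ t) : S.HasGen (S.conv p₁ t) (S.conv p t - p₁ t) := by
  have h1c := h.continuousOn
  have hI := intervalIntegrable_of_continuousOn_Ici h1c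
  -- Since `T(r) (T * p₁)(t) = (T * p₁)(t + r) - ∫ₜ^{t+r} T(t + r - s) p₁(s) ds`, the difference
  -- quotient of the orbit splits into that of `T * p₁`, with limit `(T * p)(t)`, and a mean over a
  -- shrinking interval, with limit `p₁(t)`.
  have d1 := ((S.isPrimitive_conv h).hasDerivWithinAt
    (S.continuousOn_conv h.intervalIntegrable) ht).mono (Ici_subset_Ici.2 ht)
  let q : ℝ → X := fun s => p₁ (max s 0)
  have hq : Continuous q :=
    h1c.comp_continuous (f := fun t : ℝ => max t 0) (by fun_prop) (fun _ => mem_Ici.2 (le_max_right _ _))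
  have hF : Tendsto (fun r : ℝ => r⁻¹ • ∫ s in t..(t + r), S.orbit (q s) (t + r - s))
      (𝓝[>] 0) (𝓝 (p₁ t)) := by
    -- Rescaling to `[0, 1]` turns the mean into a parameter integral that is continuous at `r = 0`.
    -- The extension `q` of `p₁` to the whole line makes the integrand jointly continuous.
    have e : ∀ r : ℝ, r ≠ 0 → r⁻¹ • ∫ s in t..(t + r), S.orbit (q s) (t + r - s)
        = ∫ s in (0 : ℝ)..1, S.orbit (q (t + r * s)) (r * (1 - s)) := by
      intro r hr
      have := intervalIntegral.integral_comp_mul_add (a := 0) (b := 1)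
        (fun s => S.orbit (q s) (t + r - s)) hr t
      simp only [mul_zero, zero_add, mul_one] at this
      rw [add_comm r t] at this
      rw [← this]
      congr 1
      ext s
      rw [add_comm (r * s) t]
      congr 1
      ring
    have hc : Continuous fun r : ℝ =>
        ∫ s in (0 : ℝ)..1, S.orbit (q (t + r * s)) (r * (1 - s)) := by
      refine intervalIntegral.continuous_parametric_intervalIntegral_of_continuous' ?_ 0 1
      exact S.continuous_orbit_uncurry.comp
        ((hq.comp (by fun_prop)).prodMk (by fun_prop))
    have h0 := (hc.tendsto 0).mono_left (nhdsWithin_le_nhds (s := Ioi 0))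
    have e0 : ∫ s in (0 : ℝ)..1, S.orbit (q (t + 0 * s)) (0 * (1 - s)) = p₁ t := by
      simp [orbit_zero, q, ht]
    rw [e0] at h0
    refine h0.congr' ?_
    filter_upwards [self_mem_nhdsWithin] with r hr
    exact (e r (ne_of_gt hr)).symm
  have d2 : Tendsto (fun r : ℝ => r⁻¹ • (S.conv p₁ (t + r) - S.conv p₁ t)) (𝓝[>] 0)
      (𝓝 (S.conv p t)) := by
    have := hasDerivWithinAt_Ioi_iff_Ici.2 d1
    rw [hasDerivWithinAt_iff_tendsto_slope' (by simp)] at this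
    have hmap : Tendsto (fun r : ℝ => t + r) (𝓝[>] 0) (𝓝[>] t) := by
      refine tendsto_nhdsWithin_iff.2 ⟨?_, ?_⟩
      · have : Tendsto (fun s : ℝ => t + s) (𝓝 0) (𝓝 (t + 0)) :=
          Continuous.tendsto (by fun_prop) 0
        rw [add_zero] at this
        exact this.mono_left nhdsWithin_le_nhds
      · filter_upwards [self_mem_nhdsWithin] with s hs
        exact lt_add_of_pos_right t hs
    refine (this.comp hmap).congr fun r => ?_
    simp [slope]
  refine (d2.sub hF).congr' ?_
  filter_upwards [self_mem_nhdsWithin] with r hr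
  have hr : 0 < r := hr
  rw [← smul_sub]
  congr 1
  have a1 : S.T r (S.conv p₁ t) = ∫ s in (0 : ℝ)..t, S.orbit (p₁ s) (t + r - s) := by
    rw [conv, ← ContinuousLinearMap.intervalIntegral_comp_comm _
      (S.intervalIntegrable_conv ht (hI t ht))]
    refine intervalIntegral.integral_congr fun s hs => ?_
    rw [uIcc_of_le ht] at hs
    rw [S.orbit_of_nonneg _ (by linarith [hs.2]), S.orbit_of_nonneg _ (by linarith [hs.2]),
      ← ContinuousLinearMap.comp_apply, ← S.map_add r _ hr.le (by linarith [hs.2])]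
    congr 2
    ring
  have a2 : ∫ s in t..(t + r), S.orbit (q s) (t + r - s)
      = ∫ s in t..(t + r), S.orbit (p₁ s) (t + r - s) := by
    refine intervalIntegral.integral_congr fun s hs => ?_
    rw [uIcc_of_le (by linarith)] at hs
    simp [q, ht.trans hs.1]
  have hI2 := S.intervalIntegrable_conv (p := p₁) (t := t + r) (by linarith)
    (hI _ (by linarith))
  have a3 : S.conv p₁ (t + r) = (∫ s in (0 : ℝ)..t, S.orbit (p₁ s) (t + r - s))
      + ∫ s in t..(t + r), S.orbit (p₁ s) (t + r - s) := by
    rw [conv, intervalIntegral.integral_add_adjacent_intervals]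
    · exact hI2.mono_set (by
        rw [uIcc_of_le ht, uIcc_of_le (by linarith)]
        exact Icc_subset_Icc_right (by linarith))
    · exact hI2.mono_set (by
        rw [uIcc_of_le (by linarith), uIcc_of_le (by linarith)]
        exact Icc_subset_Icc_left ht)
  rw [a1, a2, a3]
  abel

end C0Semigroup

/-! ### Sums of primitives and second primitives -/

section Primitive

variable {E : Type*} [NormedAddCommGroup E] [NormedSpace ℝ E]

lemma IsPrimitive.add {v w v' w' : ℝ → E} (h : IsPrimitive v w) (h' : IsPrimitive v' w') :
    IsPrimitive (fun t => v t + v' t) (fun t => w t + w' t) :=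
  ⟨fun a ha => (h.intervalIntegrable a ha).add (h'.intervalIntegrable a ha), fun t ht => by
    rw [h.eq_integral t ht, h'.eq_integral t ht, intervalIntegral.integral_add
      (h.intervalIntegrable t ht) (h'.intervalIntegrable t ht)]⟩

lemma IsPrimitive.integral {w : ℝ → E} (h : ContinuousOn w (Ici 0)) :
    IsPrimitive (fun t => ∫ s in (0 : ℝ)..t, w s) w :=
  .of_integral (intervalIntegrable_of_continuousOn_Ici h)

lemma integrableOn_prod_fst {q : ℝ → E} {a b : ℝ} (hq : IntegrableOn q (Ioc 0 a)) :
    IntegrableOn (fun z : ℝ × ℝ => q z.1) (Ioc 0 a ×ˢ Ioc 0 b) := by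
  have h1 : Integrable (fun z : ℝ × ℝ => q z.1)
      ((volume.restrict (Ioc 0 a)).prod (volume.restrict (Ioc 0 b))) := hq.comp_fst _
  rwa [Measure.prod_restrict] at h1

/-- Cauchy's formula for the second primitive. -/
lemma IsPrimitive.integral_sub_smul [CompleteSpace E] {q q₁ q₂ : ℝ → E} (h : IsPrimitive q₁ q)
    (h' : IsPrimitive q₂ q₁) {t : ℝ} (ht : 0 ≤ t) :
    ∫ s in (0 : ℝ)..t, (t - s) • q s = q₂ t := by
  have hI := h.intervalIntegrable t ht
  rw [intervalIntegrable_iff_integrableOn_Ioc_of_le ht] at hI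
  have e1 : q₂ t = ∫ r in (0 : ℝ)..t, q₁ (t - r) := by
    rw [h'.eq_integral t ht]
    simp [intervalIntegral.integral_comp_sub_left q₁ t]
  have e2 : ∫ r in (0 : ℝ)..t, q₁ (t - r) = ∫ r in (0 : ℝ)..t, ∫ s in (0 : ℝ)..(t - r), q s := by
    refine intervalIntegral.integral_congr fun r hr => ?_
    rw [uIcc_of_le ht] at hr
    exact h.eq_integral _ (by linarith [hr.2])
  rw [e1, e2, integral_triangle_swap (f := fun s _ => q s) ht (integrableOn_prod_fst hI)]
  exact intervalIntegral.integral_congr fun s _ => by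
    rw [intervalIntegral.integral_const, sub_zero]

end Primitive

/-! ### Zero-state solutions through bounded operators on `X` -/

namespace SystemNode

variable {U X Y : Type*} [NormedAddCommGroup U] [NormedSpace ℂ U] [CompleteSpace U]
    [NormedAddCommGroup X] [NormedSpace ℂ X] [CompleteSpace X]
    [NormedAddCommGroup Y] [NormedSpace ℂ Y] [CompleteSpace Y]

/-- The bounded operator `R(β, A) B : U → X`. -/
def inOp (N : SystemNode U X Y) : U →L[ℂ] X := (extResolvent N.A N.β N.β).comp N.B

/-- The bounded operator `C R(β, A) : X → Y`. -/
def outOp (N : SystemNode U X Y) : X →L[ℂ] Y := N.outRes N.β_resolvent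

lemma resolvent_injective (N : SystemNode U X Y) :
    Function.Injective (resolvent N.A N.β) := by
  intro x y h
  obtain ⟨h1, e1⟩ := (isResolventAt_resolvent N.β_resolvent).1 x
  obtain ⟨h2, e2⟩ := (isResolventAt_resolvent N.β_resolvent).1 y
  have h3 : (⟨_, h1⟩ : N.A.domain) = ⟨_, h2⟩ := Subtype.ext h
  rw [← e1, ← e2, h3, h]

lemma extResolvent_injective (N : SystemNode U X Y) :
    Function.Injective (extResolvent N.A N.β N.β) := by
  refine (injective_iff_map_eq_zero _).2 fun z hz => ?_
  rw [← norm_eq_zero, ← norm_extResolvent_self, hz, norm_zero]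

lemma emb_injective (N : SystemNode U X Y) : Function.Injective N.emb := by
  intro x y h
  apply N.resolvent_injective
  rw [← extResolvent_self_toExtra, ← extResolvent_self_toExtra]
  exact congrArg _ h

/-- The relation `z = A x + B u`, expressed in `X`. -/
def IsVelocity (N : SystemNode U X Y) (x : X) (u : U) (z : X) : Prop :=
  x - N.inOp u = resolvent N.A N.β (N.β • x - z)

/-- Apply `R(β, A) : X₋₁ → X`, which is isometric, hence injective, and sends `A x` to `β R(β, A) x
- x`. The state equation in `X₋₁` becomes an identity in `X` between bounded operators. -/
lemma isVelocity_iff (N : SystemNode U X Y) {x : X} {u : U} {z : X} :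
    N.IsVelocity x u z ↔ N.emb z = extA N.A N.β x + N.B u := by
  rw [← N.extResolvent_injective.eq_iff, map_add,
    extResolvent_extA N.dense_domain N.β_resolvent, extResolvent_self_toExtra]
  unfold IsVelocity
  change x - extResolvent N.A N.β N.β (N.B u) = _ ↔ _
  rw [map_sub, map_smul]
  constructor <;> intro h
  · rw [← sub_sub_cancel (N.β • resolvent N.A N.β x) (resolvent N.A N.β z), ← h]
    abel
  · rw [h]
    abel

lemma IsVelocity.mem_domain {N : SystemNode U X Y} {x : X} {u : U} {z : X}
    (h : N.IsVelocity x u z) : (x, u) ∈ N.CD.domain :=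
  ⟨z, (N.isVelocity_iff.1 h).symm⟩

/-- The argument `x - R(β, A) B u` of `C` equals `R(β, A) (β x - z)`, so `C` acts only through the
bounded operator `C R(β, A)`. -/
lemma IsVelocity.CD_apply {N : SystemNode U X Y} {x : X} {u : U} {z : X}
    (h : N.IsVelocity x u z) (hm : (x, u) ∈ N.CD.domain) :
    N.CD ⟨(x, u), hm⟩ = N.outOp (N.β • x - z) + N.G N.β u := by
  have hR := ((isResolventAt_resolvent N.β_resolvent).1 (N.β • x - z)).1
  rw [outOp, N.outRes_apply _ _ hR]
  change N.C ⟨x - N.inOp u, _⟩ + N.G N.β u = _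
  congr 2
  exact Subtype.ext h

lemma IsClassicalSolution.isVelocity {N : SystemNode U X Y} {u : ℝ → U} {x : ℝ → X} {y : ℝ → Y}
    (h : N.IsClassicalSolution u x y) {t : ℝ} (ht : 0 ≤ t) :
    N.IsVelocity (x t) (u t) (derivWithin x (Ici 0) t) :=
  N.isVelocity_iff.2 (h.state t ht)

lemma IsClassicalSolution.output_eq {N : SystemNode U X Y} {u : ℝ → U} {x : ℝ → X} {y : ℝ → Y}
    (h : N.IsClassicalSolution u x y) {t : ℝ} (ht : 0 ≤ t) :
    y t = N.outOp (N.β • x t - derivWithin x (Ici 0) t) + N.G N.β (u t) := by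
  rw [h.output t ht, (h.isVelocity ht).CD_apply]

/-- The state with zero initial value for an input `v` with derivative `v'`. -/
def stateOf (N : SystemNode U X Y) (v v' : ℝ → U) (t : ℝ) : X :=
  N.inOp (v t) + N.S.conv (fun s => N.inOp (N.β • v s - v' s)) t

/-- The output with zero initial state for an input `v` with derivatives `v'` and `v''`. -/
def outputOf (N : SystemNode U X Y) (v v' v'' : ℝ → U) (t : ℝ) : Y :=
  N.outOp (N.β • N.stateOf v v' t - N.stateOf v' v'' t) + N.G N.β (v t)

lemma isPrimitive_inOp (N : SystemNode U X Y) {v v' : ℝ → U} (h : IsPrimitive v v') :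
    IsPrimitive (fun t => N.inOp (v t)) (fun t => N.inOp (v' t)) :=
  h.map (N.inOp.restrictScalars ℝ)

lemma stateOf_eq (N : SystemNode U X Y) {v v' : ℝ → U} (h : IsPrimitive v v') {t : ℝ}
    (ht : 0 ≤ t) : N.stateOf v v' t = N.inOp (v t) + (N.β • N.S.conv (fun s => N.inOp (v s)) t
      - N.S.conv (fun s => N.inOp (v' s)) t) := by
  have h1 := N.isPrimitive_inOp h
  have i1 := intervalIntegrable_of_continuousOn_Ici h1.continuousOn t ht
  have i2 := h1.intervalIntegrable t ht
  unfold stateOf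
  simp only [map_sub, map_smul]
  rw [← N.S.conv_smul, N.S.conv_sub (p := fun s => N.β • N.inOp (v s)) ht (i1.smul N.β) i2]

/-- `R(β, A)` maps the state to `T * R(β, A) B v`. -/
lemma resolvent_stateOf (N : SystemNode U X Y) {v v' : ℝ → U} (h : IsPrimitive v v') {t : ℝ}
    (ht : 0 ≤ t) : resolvent N.A N.β (N.stateOf v v' t) = N.S.conv (fun s => N.inOp (v s)) t := by
  -- With `p = R(β, A) B v` and `p' = R(β, A) B v'` one has `A (T * p) = T * p' - p`, so `(β - A) (T
  -- * p)` is the expanded form of the state in `stateOf_eq`.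
  have h2 := (N.isGenerator _ _).2 (N.S.hasGen_conv (N.isPrimitive_inOp h) ht)
  rw [LinearPMap.mem_graph_iff] at h2
  obtain ⟨w, hw, hw'⟩ := h2
  have h3 := (isResolventAt_resolvent N.β_resolvent).2 w
  simp only at hw hw'
  rw [hw, hw'] at h3
  rw [← h3, N.stateOf_eq h ht]
  congr 1
  abel

/-- By `resolvent_stateOf` for `v` and for `v'`, both sides are `β (T * p) - T * p'` with `p = R(β,
A) B v` and `p' = R(β, A) B v'`. -/
lemma isVelocity_stateOf (N : SystemNode U X Y) {v v' v'' : ℝ → U} (h : IsPrimitive v v')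
    (h' : IsPrimitive v' v'') {t : ℝ} (ht : 0 ≤ t) :
    N.IsVelocity (N.stateOf v v' t) (v t) (N.stateOf v' v'' t) := by
  unfold IsVelocity
  rw [map_sub, map_smul, N.resolvent_stateOf h ht, N.resolvent_stateOf h' ht, N.stateOf_eq h ht]
  abel

lemma isPrimitive_stateOf (N : SystemNode U X Y) {v v' v'' : ℝ → U} (h : IsPrimitive v v')
    (h' : IsPrimitive v' v'') : IsPrimitive (N.stateOf v v') (N.stateOf v' v'') :=
  (N.isPrimitive_inOp h).add (N.S.isPrimitive_conv (N.isPrimitive_inOp ((h.smul N.β).sub h')))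

/-- Time invariance: with zero initial state, the map from inputs to outputs commutes with
differentiation. It holds because bounded operators and convolution with the semigroup both preserve
primitives. -/
lemma isPrimitive_outputOf (N : SystemNode U X Y) {v v' v'' v''' : ℝ → U} (h : IsPrimitive v v')
    (h' : IsPrimitive v' v'') (h'' : IsPrimitive v'' v''') :
    IsPrimitive (N.outputOf v v' v'') (N.outputOf v' v'' v''') :=
  ((((N.isPrimitive_stateOf h h').smul N.β).sub (N.isPrimitive_stateOf h' h'')).map
    (N.outOp.restrictScalars ℝ)).add (h.map ((N.G N.β).restrictScalars ℝ))

lemma continuousOn_stateOf (N : SystemNode U X Y) {v v' : ℝ → U} (h : IsPrimitive v v')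
    (hc : ContinuousOn v (Ici 0)) : ContinuousOn (N.stateOf v v') (Ici 0) := by
  refine (N.inOp.continuous.comp_continuousOn hc).add (N.S.continuousOn_conv fun a ha => ?_)
  have h1 := N.isPrimitive_inOp h
  have i1 := intervalIntegrable_of_continuousOn_Ici h1.continuousOn a ha
  simpa only [map_sub, map_smul, Pi.smul_def] using
    (i1.smul N.β).sub (h1.intervalIntegrable a ha)

/-- The derivative of the state is the state for the input `v'`, which is continuous even if `v''`
is merely locally integrable. So integrating a locally integrable input twice is enough to reach a
classical solution. -/
lemma isClassicalSolution_stateOf (N : SystemNode U X Y) {v v' v'' : ℝ → U} (h : IsPrimitive v v')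
    (h' : IsPrimitive v' v'') :
    N.IsClassicalSolution v (N.stateOf v v') (N.outputOf v v' v'') := by
  have hv := h.continuousOn
  have hc := N.continuousOn_stateOf h hv
  have hc' := N.continuousOn_stateOf h' h'.continuousOn
  have hd : ∀ t, 0 ≤ t → HasDerivWithinAt (N.stateOf v v') (N.stateOf v' v'' t) (Ici 0) t :=
    fun t ht => (N.isPrimitive_stateOf h h').hasDerivWithinAt hc' ht
  have hdw : ∀ t, 0 ≤ t → derivWithin (N.stateOf v v') (Ici 0) t = N.stateOf v' v'' t :=
    fun t ht => (hd t ht).derivWithin (uniqueDiffOn_Ici 0 t ht)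
  have hvel : ∀ t, 0 ≤ t → N.IsVelocity (N.stateOf v v' t) (v t) (N.stateOf v' v'' t) :=
    fun t ht => N.isVelocity_stateOf h h' ht
  refine ⟨hv, ?_, ?_, fun t ht => (hvel t ht).mem_domain, fun t ht => ?_, fun t ht => ?_⟩
  · rw [contDiffOn_one_iff_derivWithin (uniqueDiffOn_Ici 0)]
    exact ⟨fun t ht => (hd t ht).differentiableWithinAt, hc'.congr fun t ht => hdw t ht⟩
  · exact (N.outOp.continuous.comp_continuousOn ((hc.const_smul N.β).sub hc')).add
      ((N.G N.β).continuous.comp_continuousOn hv)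
  · rw [hdw t ht, ← N.isVelocity_iff]
    exact hvel t ht
  · rw [(hvel t ht).CD_apply]
    rfl

lemma resolvent_semigroup (N : SystemNode U X Y) {t : ℝ} (ht : 0 ≤ t) (x : X) :
    resolvent N.A N.β (N.S.T t x) = N.S.T t (resolvent N.A N.β x) := by
  obtain ⟨h1, e1⟩ := (isResolventAt_resolvent N.β_resolvent).1 x
  have h2 := (N.isGenerator _ _).2
    (((N.isGenerator _ _).1 (LinearPMap.mem_graph N.A ⟨_, h1⟩)).map ht)
  rw [LinearPMap.mem_graph_iff] at h2
  obtain ⟨w, hw, hw'⟩ := h2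
  have h3 := (isResolventAt_resolvent N.β_resolvent).2 w
  simp only at hw hw'
  rw [hw, hw', ← map_smul, ← map_sub, e1] at h3
  exact h3

/-- On `X` this is the commutation of resolvent and semigroup. The same commutation yields the norm
bound by which `T(t)` extends to `X₋₁`, and density does the rest. -/
lemma extResolvent_extT (N : SystemNode U X Y) {t : ℝ} (ht : 0 ≤ t) (z : N.XNeg) :
    extResolvent N.A N.β N.β (extT N.S N.A N.β t z)
      = N.S.T t (extResolvent N.A N.β N.β z) := by
  have hT : ∀ x, extT N.S N.A N.β t (N.emb x) = N.emb (N.S.T t x) := fun x =>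
    LinearMap.extendOfNorm_eq (f := toExtra (resolvent N.A N.β) ∘ₗ (N.S.T t).toLinearMap)
      (denseRange_toExtra _) ⟨‖N.S.T t‖, fun x => by
        change ‖toExtra _ (N.S.T t x)‖ ≤ _
        rw [norm_toExtra, norm_toExtra, N.resolvent_semigroup ht]
        exact (N.S.T t).le_opNorm _⟩ x
  refine (denseRange_toExtra _).induction_on z (isClosed_eq (by fun_prop) (by fun_prop)) ?_
  intro x
  rw [hT, extResolvent_self_toExtra, extResolvent_self_toExtra, N.resolvent_semigroup ht]

/-- An isometry preserves and reflects integrability, so `f` may be arbitrary: where it is not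
integrable, both integrals have the default value `0`. -/
lemma extResolvent_integral (N : SystemNode U X Y) (f : ℝ → N.XNeg) (t : ℝ) :
    extResolvent N.A N.β N.β (∫ s in (0 : ℝ)..t, f s)
      = ∫ s in (0 : ℝ)..t, extResolvent N.A N.β N.β (f s) := by
  have hanti : AntilipschitzWith 1 (extResolvent N.A N.β N.β) :=
    (AddMonoidHomClass.isometry_of_norm (extResolvent N.A N.β N.β)
      (norm_extResolvent_self N.A N.β)).antilipschitz
  simp only [intervalIntegral]
  rw [map_sub, ContinuousLinearMap.integral_comp_comm' _ hanti,
    ContinuousLinearMap.integral_comp_comm' _ hanti]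

/-- The twice integrated generalised solution with zero initial state is a classical solution. -/
lemma IsGeneralizedSolution.exists_output {N : SystemNode U X Y} {u : ℝ → U} {x : ℝ → N.XNeg}
    {y : 𝓓'((⊤ : TopologicalSpace.Opens ℝ), Y)} (h : N.IsGeneralizedSolution u x y)
    (hx : x 0 = 0) {u₁ u₂ : ℝ → U} (h₁ : IsPrimitive u₁ u) (h₂ : IsPrimitive u₂ u₁)
    (φ : 𝓓((⊤ : TopologicalSpace.Opens ℝ), ℝ)) :
    y φ = ∫ t in Ici (0 : ℝ), iteratedDeriv 2 (fun r => φ r) t • N.outputOf u₂ u₁ u t := by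
  obtain ⟨x₀, hx₀⟩ := h.state
  have hz : x₀ = 0 := by
    have := hx₀ 0 le_rfl
    rw [hx, N.S.map_zero] at this
    simp only [ContinuousLinearMap.id_apply, intervalIntegral.integral_same, add_zero] at this
    apply N.emb_injective
    rw [← this, map_zero]
  have hq : ∀ t, 0 ≤ t → extResolvent N.A N.β N.β (x t) = N.S.conv (fun s => N.inOp (u s)) t := by
    intro t ht
    rw [hx₀ t ht, hz, map_zero, map_zero, zero_add, N.extResolvent_integral]
    refine intervalIntegral.integral_congr fun s hs => ?_
    rw [uIcc_of_le ht] at hs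
    rw [N.extResolvent_extT (by linarith [hs.2]), N.S.orbit_of_nonneg _ (by linarith [hs.2])]
    rfl
  obtain ⟨K, F, hK, hF, -, hy⟩ := h.output
  -- After the injective `R(β, A)`, the left side is the second primitive of `T * R(β, A) B u` by
  -- Cauchy's formula. Convolution commutes with primitives, so this is `T * R(β, A) B u₂`, which is
  -- also the image of the state for `u₂`.
  have hKs : ∀ t, 0 ≤ t → K t = N.stateOf u₂ u₁ t := by
    intro t ht
    apply N.resolvent_injective
    have p1 := N.S.isPrimitive_conv (N.isPrimitive_inOp h₁)
    have p2 := N.S.isPrimitive_conv (N.isPrimitive_inOp h₂)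
    rw [N.resolvent_stateOf h₂ ht, ← p1.integral_sub_smul p2 ht, ← extResolvent_self_toExtra, hK t ht,
      N.extResolvent_integral]
    refine intervalIntegral.integral_congr fun s hs => ?_
    rw [uIcc_of_le ht] at hs
    rw [ContinuousLinearMap.map_smul_of_tower, hq s hs.1]
  rw [hy φ]
  refine setIntegral_congr_fun measurableSet_Ici fun t ht => ?_
  have ht : 0 ≤ t := ht
  have h3 := hF t ht
  rw [h₁.integral_sub_smul h₂ ht, hKs t ht, LinearPMap.mem_graph_iff] at h3
  obtain ⟨⟨p, hp⟩, rfl, hw'⟩ := h3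
  simp only at hw' ⊢
  rw [← hw', (N.isVelocity_stateOf h₂ h₁ ht).CD_apply]
  rfl

end SystemNode

/-! ### Pairing functions with values in `E*` and in `E` -/

section AntiDual

variable {E : Type*} [NormedAddCommGroup E] [NormedSpace ℂ E]

/-- The evaluation `(φ, x) ↦ φ x` as a real bilinear map. -/
def evalL (E : Type*) [NormedAddCommGroup E] [NormedSpace ℂ E] : AntiDual E →L[ℝ] E →L[ℝ] ℂ :=
  LinearMap.mkContinuous₂ (LinearMap.mk₂ ℝ (fun (φ : AntiDual E) (x : E) => φ x)
    (fun _ _ _ => rfl) (fun _ _ _ => rfl) (fun φ x y => map_add φ x y)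
    (fun c φ x => map_real_smul φ φ.continuous c x)) 1
    (fun φ x => by simpa using φ.le_opNorm x)

@[simp] lemma evalL_apply (φ : AntiDual E) (x : E) : evalL E φ x = φ x := rfl

lemma intervalIntegrable_eval {f : ℝ → AntiDual E} {g : ℝ → E} {a : ℝ} (ha : 0 ≤ a)
    (hf : IntervalIntegrable f volume 0 a) (hg : ContinuousOn g (Ici 0)) :
    IntervalIntegrable (fun t => f t (g (a - t))) volume 0 a := by
  have hc : ContinuousOn (fun t => g (a - t)) (Icc 0 a) :=
    hg.comp (by fun_prop) (fun t ht => by simpa using ht.2)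
  obtain ⟨C, hC⟩ := isCompact_Icc.exists_bound_of_continuousOn hc
  rw [intervalIntegrable_iff_integrableOn_Ioc_of_le ha] at hf ⊢
  have hg' : AEStronglyMeasurable (fun t => g (a - t)) (volume.restrict (Ioc 0 a)) :=
    (hc.mono Ioc_subset_Icc_self).aestronglyMeasurable measurableSet_Ioc
  refine Integrable.mono' (hf.norm.mul_const C)
    ((evalL E).aestronglyMeasurable_comp₂ hf.aestronglyMeasurable hg') ?_
  filter_upwards [ae_restrict_mem measurableSet_Ioc] with t ht
  exact (f t).le_opNorm_of_le (hC t (Ioc_subset_Icc_self ht))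

/-- Integration by parts for convolutions. -/
lemma IsPrimitive.integral_eval {v w : ℝ → AntiDual E} {g h : ℝ → E} (hv : IsPrimitive v w)
    (hg : IsPrimitive g h) (hc : ContinuousOn h (Ici 0)) [CompleteSpace E] {a : ℝ} (ha : 0 ≤ a) :
    ∫ t in (0 : ℝ)..a, v (a - t) (h t) = ∫ t in (0 : ℝ)..a, w t (g (a - t)) := by
  have i1 := hv.intervalIntegrable a ha
  have i2 := hg.intervalIntegrable a ha
  -- Both sides are the integral of `w s (h t)` over the triangle `s + t ≤ a`. Fubini replaces
  -- differentiation because `w` is only locally integrable, and `v` need not be differentiable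
  -- everywhere.
  have e1 : ∫ t in (0 : ℝ)..a, v (a - t) (h t)
      = ∫ t in (0 : ℝ)..a, ∫ s in (0 : ℝ)..(a - t), w s (h t) := by
    refine intervalIntegral.integral_congr fun t ht => ?_
    rw [uIcc_of_le ha] at ht
    have hat : 0 ≤ a - t := by linarith [ht.2]
    have := ((evalL E).flip (h t)).intervalIntegral_comp_comm (hv.intervalIntegrable _ hat)
    rw [hv.eq_integral _ hat]
    exact this.symm
  have e2 : ∫ s in (0 : ℝ)..a, w s (g (a - s))
      = ∫ s in (0 : ℝ)..a, ∫ t in (0 : ℝ)..(a - s), w s (h t) := by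
    refine intervalIntegral.integral_congr fun s hs => ?_
    rw [uIcc_of_le ha] at hs
    have hat : 0 ≤ a - s := by linarith [hs.2]
    have := (evalL E (w s)).intervalIntegral_comp_comm (hg.intervalIntegrable _ hat)
    rw [hg.eq_integral _ hat]
    exact this.symm
  rw [e1, e2]
  refine integral_triangle_swap ha ?_
  obtain ⟨C, hC⟩ := isCompact_Icc.exists_bound_of_continuousOn
    (hc.mono (Icc_subset_Ici_self : Icc 0 a ⊆ Ici 0))
  rw [intervalIntegrable_iff_integrableOn_Ioc_of_le ha] at i1 i2
  have j1 := integrableOn_prod_fst (b := a) i1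
  have j2 : AEStronglyMeasurable (fun z : ℝ × ℝ => h z.2)
      (volume.restrict (Ioc 0 a ×ˢ Ioc 0 a)) := by
    have : Integrable (fun z : ℝ × ℝ => h z.2)
      ((volume.restrict (Ioc 0 a)).prod (volume.restrict (Ioc 0 a))) := i2.comp_snd _
    rw [Measure.prod_restrict] at this
    exact this.aestronglyMeasurable
  refine Integrable.mono' (j1.norm.mul_const C)
    ((evalL E).aestronglyMeasurable_comp₂ j1.aestronglyMeasurable j2) ?_
  filter_upwards [ae_restrict_mem (measurableSet_Ioc.prod measurableSet_Ioc)] with z hz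
  exact (w z.1).le_opNorm_of_le (hC _ (Ioc_subset_Icc_self hz.2))

end AntiDual

/-! ### The pairing between a node and its dual -/

namespace SystemNode

variable {U X Y : Type*} [NormedAddCommGroup U] [NormedSpace ℂ U] [CompleteSpace U]
    [NormedAddCommGroup X] [NormedSpace ℂ X] [CompleteSpace X]
    [NormedAddCommGroup Y] [NormedSpace ℂ Y] [CompleteSpace Y]

/-- Dualising exchanges `R(β, A) B` and `C R(β, A)` and takes adjoints; the other half of the
exchange is `dual_outOp`. In bounded operators the dual node thus needs no extrapolation space. -/
lemma dual_inOp (N : SystemNode U X Y) (hA : GeneratesC0 (adjoint N.A)) (η : AntiDual Y) :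
    (N.dual hA).inOp η = adj N.outOp η := N.extResolvent_dualB hA η

lemma dual_resolvent (N : SystemNode U X Y) (hA : GeneratesC0 (adjoint N.A)) :
    resolvent (N.dual hA).A (N.dual hA).β = adj (resolvent N.A N.β) :=
  N.resolvent_adjoint N.β_resolvent

lemma dual_outOp (N : SystemNode U X Y) (hA : GeneratesC0 (adjoint N.A)) (ψ : AntiDual X) :
    (N.dual hA).outOp ψ = adj N.inOp ψ := by
  obtain ⟨h, e⟩ := (isResolventAt_resolvent (N.dual hA).β_resolvent).1 ψ
  rw [outOp, outRes_apply _ _ _ h]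
  exact congrArg (adj N.inOp) e

lemma dual_G (N : SystemNode U X Y) (hA : GeneratesC0 (adjoint N.A)) :
    (N.dual hA).G (N.dual hA).β = adj (N.G N.β) := by
  change adj (N.G (conj (conj N.β))) = _
  rw [Complex.conj_conj]

/-- The duality relation between a system node and its dual node. -/
lemma duality (N : SystemNode U X Y) (hA : GeneratesC0 (adjoint N.A)) {x z : X} {u : U}
    (h : N.IsVelocity x u z) {φ ψ : AntiDual X} {η : AntiDual Y}
    (h' : (N.dual hA).IsVelocity φ η ψ) :
    ((N.dual hA).outOp ((N.dual hA).β • φ - ψ) + (N.dual hA).G (N.dual hA).β η) u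
      = η (N.outOp (N.β • x - z) + N.G N.β u) + (φ z - ψ x) := by
  unfold IsVelocity at h h'
  rw [dual_inOp, dual_resolvent] at h'
  rw [dual_outOp, dual_G]
  -- The dual state equation is evaluated at `β x - z`. The resolvent moves to the other side of the
  -- pairing, where the state equation of the node replaces `R(β, A) (β x - z)` by `x - R(β, A) B
  -- u`.
  have h1 := congrArg (fun f : AntiDual X => f (N.β • x - z)) h'
  change φ (N.β • x - z) - η (N.outOp (N.β • x - z))
    = (conj N.β • φ - ψ) (resolvent N.A N.β (N.β • x - z)) at h1
  rw [← h] at h1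
  change (conj N.β • φ - ψ) (N.inOp u) + η (N.G N.β u) = _
  change _ = conj N.β • φ (x - N.inOp u) - ψ (x - N.inOp u) at h1
  change conj N.β • φ (N.inOp u) - ψ (N.inOp u) + η (N.G N.β u) = _
  simp only [map_add, map_sub, map_smulₛₗ, smul_eq_mul] at h1 ⊢
  linear_combination h1

/-- The duality between classical solutions with zero initial states. -/
lemma integral_duality (N : SystemNode U X Y) (hA : GeneratesC0 (adjoint N.A))
    {u : ℝ → U} {x : ℝ → X} {y : ℝ → Y} (h : N.IsClassicalSolution u x y) (hx : x 0 = 0)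
    {η : ℝ → AntiDual Y} {φ : ℝ → AntiDual X} {θ : ℝ → AntiDual U}
    (h' : (N.dual hA).IsClassicalSolution η φ θ) (hφ : φ 0 = 0) {a : ℝ} (ha : 0 ≤ a) :
    ∫ t in (0 : ℝ)..a, θ t (u (a - t)) = ∫ t in (0 : ℝ)..a, η t (y (a - t)) := by
  have dx := (contDiffOn_one_iff_derivWithin (uniqueDiffOn_Ici 0)).1 h.contDiffOn_x
  have dφ := (contDiffOn_one_iff_derivWithin (uniqueDiffOn_Ici 0)).1 h'.contDiffOn_x
  set x' := derivWithin x (Ici 0) with hx'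
  set φ' := derivWithin φ (Ici 0) with hφ'
  have key : ∀ t ∈ Icc 0 a, θ t (u (a - t)) - η t (y (a - t))
      = φ t (x' (a - t)) - φ' t (x (a - t)) := by
    intro t ht
    have hat : 0 ≤ a - t := by linarith [ht.2]
    rw [h'.output_eq ht.1, h.output_eq hat,
      N.duality hA (h.isVelocity hat) (h'.isVelocity ht.1)]
    ring
  have i1 := intervalIntegrable_eval ha
    (intervalIntegrable_of_continuousOn_Ici h'.continuousOn_y a ha) h.continuousOn_u
  have i2 := intervalIntegrable_eval ha
    (intervalIntegrable_of_continuousOn_Ici h'.continuousOn_u a ha) h.continuousOn_y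
  have i3 := intervalIntegrable_eval ha
    (intervalIntegrable_of_continuousOn_Ici h'.contDiffOn_x.continuousOn a ha) dx.2
  have i4 := intervalIntegrable_eval ha
    (intervalIntegrable_of_continuousOn_Ici dφ.2 a ha) h.contDiffOn_x.continuousOn
  rw [← sub_eq_zero, ← intervalIntegral.integral_sub i1 i2]
  have e : ∫ t in (0 : ℝ)..a, (θ t (u (a - t)) - η t (y (a - t)))
      = ∫ t in (0 : ℝ)..a, (φ t (x' (a - t)) - φ' t (x (a - t))) := by
    refine intervalIntegral.integral_congr fun t ht => ?_
    rw [uIcc_of_le ha] at ht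
    exact key t ht
  rw [e]
  have hsub : MapsTo (fun t => a - t) (Icc 0 a) (Ici 0) := fun t ht => by simpa using ht.2
  -- The integrand is the derivative of `-φ(t) (x(a - t))`. The boundary terms vanish, at `t = a` by
  -- `x 0 = 0` and at `t = 0` by `φ 0 = 0`.
  have := intervalIntegral.integral_eq_sub_of_hasDerivAt_of_le ha
    (f := fun t => -(φ t (x (a - t)))) (f' := fun t => φ t (x' (a - t)) - φ' t (x (a - t)))
    ?_ ?_ (i3.sub i4)
  · rw [this]
    simp [hx, hφ]
  · refine ContinuousOn.neg ?_
    exact (evalL X).continuous₂.comp_continuousOn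
      ((h'.contDiffOn_x.continuousOn.mono Icc_subset_Ici_self).prodMk
        (h.contDiffOn_x.continuousOn.comp (by fun_prop) hsub))
  · intro t ht
    have hat : 0 < a - t := by linarith [ht.2]
    have d1 : HasDerivAt φ (φ' t) t :=
      ((dφ.1 t ht.1.le).hasDerivWithinAt).hasDerivAt (Ici_mem_nhds ht.1)
    have d2 : HasDerivAt x (x' (a - t)) (a - t) :=
      ((dx.1 _ hat.le).hasDerivWithinAt).hasDerivAt (Ici_mem_nhds hat)
    have d3 : HasDerivAt (fun t => x (a - t)) (-x' (a - t)) t := by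
      have := d2.scomp t ((hasDerivAt_id t).const_sub a)
      simpa [Function.comp_def] using this
    have d4 := ((evalL X).hasDerivAt_of_bilinear (fun _ => d1) (fun _ => d3)).neg
    refine d4.congr_deriv ?_
    simp
    ring

end SystemNode

/-! ### Smooth inputs, and essential bounds by testing -/

section Smooth

variable {E : Type*} [NormedAddCommGroup E] [NormedSpace ℝ E] [CompleteSpace E]

lemma contDiff_iteratedDeriv {v : ℝ → E} (h : ContDiff ℝ ∞ v) (k : ℕ) :
    ContDiff ℝ ∞ (iteratedDeriv k v) := by
  induction k with
  | zero => simpa using h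
  | succ k ih =>
    rw [iteratedDeriv_succ]
    exact (contDiff_infty_iff_deriv.1 ih).2

lemma tsupport_iteratedDeriv_subset (v : ℝ → E) (k : ℕ) :
    tsupport (iteratedDeriv k v) ⊆ tsupport v := by
  induction k with
  | zero => simp
  | succ k ih =>
    rw [iteratedDeriv_succ]
    exact tsupport_deriv_subset.trans ih

/-- Support in the open half-line makes every derivative vanish at `0`, the initial condition
contained in `IsPrimitive`. -/
lemma isPrimitive_iteratedDeriv {v : ℝ → E} (h : ContDiff ℝ ∞ v) (hs : tsupport v ⊆ Ioi 0)
    (k : ℕ) : IsPrimitive (iteratedDeriv k v) (iteratedDeriv (k + 1) v) := by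
  refine .of_hasDerivWithinAt ?_ (fun t _ => ?_) (contDiff_iteratedDeriv h _).continuous.continuousOn
  · refine image_eq_zero_of_notMem_tsupport fun h0 => ?_
    exact lt_irrefl (0 : ℝ) (mem_Ioi.1 (hs (tsupport_iteratedDeriv_subset v k h0)))
  · rw [iteratedDeriv_succ]
    exact ((contDiff_iteratedDeriv h k).differentiable (by simp) t).hasDerivAt.hasDerivWithinAt

lemma ofReal_integral_norm_eq_eLpNorm_one {f : ℝ → E} {a : ℝ} (ha : 0 ≤ a)
    (hf : ContinuousOn f (Icc 0 a)) :
    ENNReal.ofReal (∫ t in (0 : ℝ)..a, ‖f t‖) = eLpNorm f 1 (volume.restrict (Icc 0 a)) := by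
  rw [intervalIntegral.integral_of_le ha, ← integral_Icc_eq_integral_Ioc,
    eLpNorm_one_eq_lintegral_enorm,
    ofReal_integral_norm_eq_lintegral_enorm (hf.integrableOn_compact isCompact_Icc)]

/-- A function whose integrals against test functions are bounded by the `L¹`-norms of the test
functions is essentially bounded. -/
lemma ae_norm_le_of_norm_integral_smul_le {f : ℝ → E} {a b M : ℝ} (hf : IntegrableOn f (Ioo a b))
    (h : ∀ ρ : ℝ → ℝ, ContDiff ℝ ∞ ρ → HasCompactSupport ρ → tsupport ρ ⊆ Ioo a b →
      ‖∫ t in Ioo a b, ρ t • f t‖ ≤ M * ∫ t in Ioo a b, |ρ t|) :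
    ∀ᵐ t ∂(volume.restrict (Ioo a b)), ‖f t‖ ≤ M := by
  -- The radii tend to `0` with the fixed ratio `2`, so the regularisations converge almost
  -- everywhere for any locally integrable function.
  let φ : ℕ → ContDiffBump (0 : ℝ) := fun n =>
    ⟨1 / ((n : ℝ) + 1) / 2, 1 / ((n : ℝ) + 1), by positivity,
      half_lt_self (by positivity)⟩
  have hφ : Tendsto (fun n => (φ n).rOut) atTop (𝓝 0) := tendsto_one_div_add_atTop_nhds_zero_nat
  have hg : Integrable ((Ioo a b).indicator f) := hf.integrable_indicator measurableSet_Ioo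
  have lim := ContDiffBump.ae_convolution_tendsto_right_of_locallyIntegrable (μ := volume)
    (φ := φ) (K := 2) hφ (Eventually.of_forall fun n => by simp only [φ]; linarith)
    hg.locallyIntegrable
  rw [ae_restrict_iff' measurableSet_Ioo]
  filter_upwards [lim] with x hx hxab
  rw [indicator_of_mem hxab] at hx
  refine le_of_tendsto hx.norm ?_
  have hev : ∀ᶠ n in atTop, Metric.closedBall x (φ n).rOut ⊆ Ioo a b := by
    obtain ⟨ε, hε, hsub⟩ := Metric.isOpen_iff.1 isOpen_Ioo x hxab
    filter_upwards [hφ.eventually_lt_const hε] with n hn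
    exact (Metric.closedBall_subset_ball hn).trans hsub
  filter_upwards [hev] with n hn
  -- The regularisation at `x` is the integral of `f` against this `ρ`, whose `L¹` norm is `1`. Once
  -- the ball lies in `Ioo a b`, the hypothesis bounds it by `M`.
  let ρ : ℝ → ℝ := fun t => (φ n).normed volume (x - t)
  have hts : tsupport ρ ⊆ Metric.closedBall x (φ n).rOut := by
    refine closure_minimal (fun t ht => ?_) Metric.isClosed_closedBall
    have : x - t ∈ Function.support ((φ n).normed volume) := ht
    rw [ContDiffBump.support_normed_eq] at this
    rw [Metric.mem_ball, dist_zero_right] at this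
    rw [Metric.mem_closedBall, dist_comm, dist_eq_norm]
    exact this.le
  have e1 : convolution ((φ n).normed volume) ((Ioo a b).indicator f)
      (ContinuousLinearMap.lsmul ℝ ℝ) volume x = ∫ t in Ioo a b, ρ t • f t := by
    rw [convolution_eq_swap, ← integral_indicator measurableSet_Ioo]
    congr 1
    ext t
    by_cases ht : t ∈ Ioo a b <;> simp [ht, ρ]
  have e2 : ∫ t in Ioo a b, |ρ t| = 1 := by
    rw [setIntegral_eq_integral_of_forall_compl_eq_zero]
    · have : ∀ t, |ρ t| = (φ n).normed volume (x - t) := fun t =>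
        abs_of_nonneg ((φ n).nonneg_normed _)
      simp only [this]
      rw [integral_sub_left_eq_self (fun t => (φ n).normed volume t) volume x,
        ContDiffBump.integral_normed]
    · intro t ht
      rw [image_eq_zero_of_notMem_tsupport (fun h => ht (hn (hts h))), abs_zero]
  rw [e1]
  have := h ρ ((φ n).contDiff_normed.comp (contDiff_const.sub contDiff_id))
    (HasCompactSupport.of_support_subset_isCompact (isCompact_closedBall x (φ n).rOut)
      ((subset_tsupport ρ).trans hts)) (hts.trans hn)
  rwa [e2, mul_one] at this

end Smooth

/-! ### Transfer of the LILO estimate to outputs of the dual node -/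

namespace SystemNode

variable {U X Y : Type*} [NormedAddCommGroup U] [NormedSpace ℂ U] [CompleteSpace U]
    [NormedAddCommGroup X] [NormedSpace ℂ X] [CompleteSpace X]
    [NormedAddCommGroup Y] [NormedSpace ℂ Y] [CompleteSpace Y]

/-- The estimate in the definition of `C^∞`-LILO stability. -/
def LILOBound (N : SystemNode U X Y) (c : ℝ) : Prop :=
  ∀ (u : ℝ → U) (x : ℝ → X) (y : ℝ → Y), N.IsClassicalSolution u x y →
    ContDiff ℝ ∞ u → HasCompactSupport u → tsupport u ⊆ Ioi 0 → x 0 = 0 →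
    LocallyIntegrableOn y (Ici 0) ∧
    ∀ t, 0 < t → eLpNorm y 1 (volume.restrict (Icc 0 t))
      ≤ ENNReal.ofReal c * eLpNorm u 1 (volume.restrict (Icc 0 t))

/-- The output with zero initial state for a smooth input. -/
def smoothOutput (N : SystemNode U X Y) (v : ℝ → U) (k : ℕ) : ℝ → Y :=
  N.outputOf (iteratedDeriv k v) (iteratedDeriv (k + 1) v) (iteratedDeriv (k + 2) v)

lemma stateOf_zero (N : SystemNode U X Y) {v v' : ℝ → U} (h : IsPrimitive v v') :
    N.stateOf v v' 0 = 0 := by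
  simp [stateOf, C0Semigroup.conv_zero, h.eq_integral 0 le_rfl]

lemma smoothOutput_spec (N : SystemNode U X Y) {v : ℝ → U} (h : ContDiff ℝ ∞ v)
    (hs : tsupport v ⊆ Ioi 0) (k : ℕ) :
    N.IsClassicalSolution (iteratedDeriv k v) (N.stateOf (iteratedDeriv k v)
      (iteratedDeriv (k + 1) v)) (N.smoothOutput v k) :=
  N.isClassicalSolution_stateOf (isPrimitive_iteratedDeriv h hs k)
    (isPrimitive_iteratedDeriv h hs (k + 1))

lemma isPrimitive_smoothOutput (N : SystemNode U X Y) {v : ℝ → U} (h : ContDiff ℝ ∞ v)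
    (hs : tsupport v ⊆ Ioi 0) (k : ℕ) :
    IsPrimitive (N.smoothOutput v k) (N.smoothOutput v (k + 1)) :=
  N.isPrimitive_outputOf (isPrimitive_iteratedDeriv h hs k)
    (isPrimitive_iteratedDeriv h hs (k + 1)) (isPrimitive_iteratedDeriv h hs (k + 2))

/-- The stability hypothesis enters the estimates only here, through the explicit zero-state
solution with input `v`. -/
lemma LILOBound.integral_norm_le {N : SystemNode U X Y} {c : ℝ} (hc : N.LILOBound c) (hc0 : 0 < c)
    {v : ℝ → U} (h : ContDiff ℝ ∞ v) (hcs : HasCompactSupport v) (hs : tsupport v ⊆ Ioi 0) {a : ℝ}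
    (ha : 0 < a) :
    ∫ t in (0 : ℝ)..a, ‖N.smoothOutput v 0 t‖ ≤ c * ∫ t in (0 : ℝ)..a, ‖v t‖ := by
  have hsol := N.smoothOutput_spec h hs 0
  have hb := (hc v _ _ (by simpa using hsol) h hcs hs
    (N.stateOf_zero (by simpa using isPrimitive_iteratedDeriv h hs 0))).2 a ha
  rw [← ofReal_integral_norm_eq_eLpNorm_one ha.le (hsol.continuousOn_y.mono Icc_subset_Ici_self),
    ← ofReal_integral_norm_eq_eLpNorm_one ha.le h.continuous.continuousOn,
    ← ENNReal.ofReal_mul hc0.le] at hb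
  refine (ENNReal.ofReal_le_ofReal_iff ?_).1 hb
  exact mul_nonneg hc0.le (intervalIntegral.integral_nonneg ha.le fun _ _ => norm_nonneg _)

/-- The basic estimate behind both parts of the duality theorem. -/
lemma LILOBound.norm_integral_le {N : SystemNode U X Y} {c : ℝ} (hc : N.LILOBound c) (hc0 : 0 < c)
    {η : ℝ → AntiDual Y} {a m : ℝ} (ha : 0 < a) (hm0 : 0 ≤ m)
    (hm : ∀ᵐ t ∂(volume.restrict (Icc 0 a)), ‖η t‖ ≤ m) {v : ℝ → U}
    (h : ContDiff ℝ ∞ v) (hcs : HasCompactSupport v) (hs : tsupport v ⊆ Ioi 0) :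
    ‖∫ t in (0 : ℝ)..a, η t (N.smoothOutput v 0 (a - t))‖
      ≤ m * c * ∫ t in (0 : ℝ)..a, ‖v (a - t)‖ := by
  have hsol := N.smoothOutput_spec h hs 0
  have hcont : ContinuousOn (fun t => ‖N.smoothOutput v 0 (a - t)‖) (Icc 0 a) :=
    (hsol.continuousOn_y.comp (by fun_prop) (fun t ht => by simpa using ht.2)).norm
  have e1 : ‖∫ t in (0 : ℝ)..a, η t (N.smoothOutput v 0 (a - t))‖
      ≤ ∫ t in (0 : ℝ)..a, m * ‖N.smoothOutput v 0 (a - t)‖ := by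
    refine intervalIntegral.norm_integral_le_of_norm_le ha.le ?_ ?_
    · have := (ae_restrict_iff' measurableSet_Icc).1 hm
      filter_upwards [this] with t ht hta
      exact (η t).le_of_opNorm_le (ht (Ioc_subset_Icc_self hta)) _
    · exact (hcont.intervalIntegrable_of_Icc ha.le).const_mul m
  refine e1.trans ?_
  rw [intervalIntegral.integral_const_mul, mul_assoc]
  refine mul_le_mul_of_nonneg_left ?_ hm0
  have r1 := intervalIntegral.integral_comp_sub_left (a := 0) (b := a)
    (fun t => ‖N.smoothOutput v 0 t‖) a
  have r2 := intervalIntegral.integral_comp_sub_left (a := 0) (b := a) (fun t => ‖v t‖) a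
  simp only [sub_self, sub_zero] at r1 r2
  rw [r1, r2]
  exact hc.integral_norm_le hc0 h hcs hs ha

/-- The reflected test function `t ↦ ρ(a - t) u₀`. -/
def reflect (ρ : ℝ → ℝ) (a : ℝ) (u₀ : U) (t : ℝ) : U := ρ (a - t) • u₀

lemma contDiff_reflect {ρ : ℝ → ℝ} (h : ContDiff ℝ ∞ ρ) (a : ℝ) (u₀ : U) :
    ContDiff ℝ ∞ (reflect ρ a u₀) :=
  (h.comp (contDiff_const.sub contDiff_id)).smul contDiff_const

lemma tsupport_reflect_subset (ρ : ℝ → ℝ) (a : ℝ) (u₀ : U) :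
    tsupport (reflect ρ a u₀) ⊆ (fun t => a - t) ⁻¹' tsupport ρ := by
  refine closure_minimal (fun t ht => subset_tsupport ρ ?_)
    ((isClosed_tsupport ρ).preimage (by fun_prop))
  intro h0
  exact ht (by simp [reflect, h0])

/-- A test function may extend to negative times. It only has to stay left of `a`, since reflection
then gives an admissible input of the node. -/
lemma tsupport_reflect_subset_Ioi {ρ : ℝ → ℝ} {a : ℝ} (hs : tsupport ρ ⊆ Iio a) (u₀ : U) :
    tsupport (reflect ρ a u₀) ⊆ Ioi 0 := fun t ht => by
  have : a - t < a := hs (tsupport_reflect_subset ρ a u₀ ht)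
  exact mem_Ioi.2 (by linarith)

lemma hasCompactSupport_reflect {ρ : ℝ → ℝ} (h : HasCompactSupport ρ) (a : ℝ) (u₀ : U) :
    HasCompactSupport (reflect ρ a u₀) := by
  refine IsCompact.of_isClosed_subset ?_ (isClosed_tsupport _) (tsupport_reflect_subset ρ a u₀)
  exact (Homeomorph.subLeft a).isCompact_preimage.2 h

lemma iteratedDeriv_two_reflect {ρ : ℝ → ℝ} (h : ContDiff ℝ ∞ ρ) (a : ℝ) (u₀ : U) (t : ℝ) :
    iteratedDeriv 2 (reflect ρ a u₀) t = iteratedDeriv 2 ρ (a - t) • u₀ := by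
  have hc : ContDiff ℝ 2 (fun t => ρ (a - t)) :=
    contDiff_infty.1 (h.comp (contDiff_const.sub contDiff_id)) 2
  change iteratedDeriv 2 (fun t => ρ (a - t) • u₀) t = _
  rw [iteratedDeriv_smul_const hc.contDiffAt, iteratedDeriv_comp_const_sub]
  simp

/-- Pairings of the twice integrated dual output with test functions. -/
lemma LILOBound.norm_integral_iteratedDeriv_smul_le {N : SystemNode U X Y} {c : ℝ}
    (hc : N.LILOBound c) (hc0 : 0 < c) (hA : GeneratesC0 (adjoint N.A))
    {η η₁ η₂ : ℝ → AntiDual Y} (h₁ : IsPrimitive η₁ η) (h₂ : IsPrimitive η₂ η₁)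
    {a m : ℝ} (ha : 0 < a) (hm0 : 0 ≤ m) (hm : ∀ᵐ t ∂(volume.restrict (Icc 0 a)), ‖η t‖ ≤ m)
    {ρ : ℝ → ℝ} (h : ContDiff ℝ ∞ ρ) (hcs : HasCompactSupport ρ) (hs : tsupport ρ ⊆ Iio a) :
    ‖∫ t in (0 : ℝ)..a, iteratedDeriv 2 ρ t • (N.dual hA).outputOf η₂ η₁ η t‖
      ≤ m * c * ∫ t in (0 : ℝ)..a, |ρ t| := by
  set θ := (N.dual hA).outputOf η₂ η₁ η
  have hdual := (N.dual hA).isClassicalSolution_stateOf h₂ h₁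
  have hI : IntervalIntegrable (fun t => iteratedDeriv 2 ρ t • θ t) volume 0 a :=
    intervalIntegrable_of_continuousOn_Ici
      ((contDiff_iteratedDeriv h 2).continuous.continuousOn.smul hdual.continuousOn_y) a ha.le
  have hnn : 0 ≤ ∫ t in (0 : ℝ)..a, |ρ t| :=
    intervalIntegral.integral_nonneg ha.le fun _ _ => abs_nonneg _
  -- The norm in `U*` is tested on a vector `u₀`. The input `v` satisfies `v(a - t) = ρ(t) u₀`, and
  -- in its second derivative the signs from the reflection cancel.
  refine ContinuousLinearMap.opNorm_le_bound _ (by positivity) fun u₀ => ?_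
  set v := reflect ρ a u₀ with hv
  have hvd := contDiff_reflect h a u₀
  have hvs := tsupport_reflect_subset_Ioi hs u₀
  have e1 : (∫ t in (0 : ℝ)..a, iteratedDeriv 2 ρ t • θ t) u₀
      = ∫ t in (0 : ℝ)..a, θ t (iteratedDeriv 2 v (a - t)) := by
    have := ((evalL U).flip u₀).intervalIntegral_comp_comm hI
    refine Eq.trans this.symm ?_
    congr 1
    ext t
    rw [iteratedDeriv_two_reflect h, sub_sub_cancel, map_real_smul (θ t) (θ t).continuous]
    rfl
  have hprim := N.isPrimitive_smoothOutput hvd hvs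
  have refl : ∀ (f : ℝ → AntiDual Y) (g : ℝ → Y),
      ∫ t in (0 : ℝ)..a, f t (g (a - t)) = ∫ t in (0 : ℝ)..a, f (a - t) (g t) := fun f g => by
    have := intervalIntegral.integral_comp_sub_left (a := 0) (b := a) (fun t => f t (g (a - t))) a
    simpa using this.symm
  -- Duality passes to `η₂` paired with the output of `v''`. Two integrations by parts then replace
  -- `η₂` by `η` and the output of `v''` by that of `v`; `refl` restores the shape needed for each.
  rw [e1, N.integral_duality hA (N.smoothOutput_spec hvd hvs 2)
    (N.stateOf_zero (isPrimitive_iteratedDeriv hvd hvs 2)) hdual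
    ((N.dual hA).stateOf_zero h₂) ha.le, refl,
    h₂.integral_eval (hprim 1) (N.smoothOutput_spec hvd hvs 2).continuousOn_y ha.le, refl,
    h₁.integral_eval (hprim 0) (N.smoothOutput_spec hvd hvs 1).continuousOn_y ha.le]
  refine (hc.norm_integral_le hc0 ha hm0 hm hvd (hasCompactSupport_reflect hcs a u₀) hvs).trans ?_
  rw [mul_assoc _ _ ‖u₀‖, ← intervalIntegral.integral_mul_const]
  simp [reflect, norm_smul]

/-- Pairings of a dual classical output with test functions. -/
lemma LILOBound.norm_integral_smul_le {N : SystemNode U X Y} {c : ℝ}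
    (hc : N.LILOBound c) (hc0 : 0 < c) (hA : GeneratesC0 (adjoint N.A))
    {η : ℝ → AntiDual Y} {φ : ℝ → AntiDual X} {θ : ℝ → AntiDual U}
    (hsol : (N.dual hA).IsClassicalSolution η φ θ) (hφ : φ 0 = 0)
    {a m : ℝ} (ha : 0 < a) (hm0 : 0 ≤ m) (hm : ∀ᵐ t ∂(volume.restrict (Icc 0 a)), ‖η t‖ ≤ m)
    {ρ : ℝ → ℝ} (h : ContDiff ℝ ∞ ρ) (hcs : HasCompactSupport ρ) (hs : tsupport ρ ⊆ Iio a) :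
    ‖∫ t in (0 : ℝ)..a, ρ t • θ t‖ ≤ m * c * ∫ t in (0 : ℝ)..a, |ρ t| := by
  have hI : IntervalIntegrable (fun t => ρ t • θ t) volume 0 a :=
    intervalIntegrable_of_continuousOn_Ici
      (h.continuous.continuousOn.smul hsol.continuousOn_y) a ha.le
  have hnn : 0 ≤ ∫ t in (0 : ℝ)..a, |ρ t| :=
    intervalIntegral.integral_nonneg ha.le fun _ _ => abs_nonneg _
  refine ContinuousLinearMap.opNorm_le_bound _ (by positivity) fun u₀ => ?_
  set v := reflect ρ a u₀ with hv
  have hvd := contDiff_reflect h a u₀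
  have hvs := tsupport_reflect_subset_Ioi hs u₀
  have e1 : (∫ t in (0 : ℝ)..a, ρ t • θ t) u₀ = ∫ t in (0 : ℝ)..a, θ t (v (a - t)) := by
    have := ((evalL U).flip u₀).intervalIntegral_comp_comm hI
    refine Eq.trans this.symm ?_
    congr 1
    ext t
    simp only [hv, reflect, sub_sub_cancel]
    rw [map_real_smul (θ t) (θ t).continuous]
    rfl
  have hsol0 := N.smoothOutput_spec hvd hvs 0
  rw [iteratedDeriv_zero] at hsol0
  rw [e1, N.integral_duality hA hsol0
    (N.stateOf_zero (by simpa using isPrimitive_iteratedDeriv hvd hvs 0)) hsol hφ ha.le]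
  refine (hc.norm_integral_le hc0 ha hm0 hm hvd (hasCompactSupport_reflect hcs a u₀) hvs).trans ?_
  rw [mul_assoc _ _ ‖u₀‖, ← intervalIntegral.integral_mul_const]
  simp [reflect, norm_smul]

end SystemNode

/-! ### Densities of operators and distributions under the Radon–Nikodým property -/

section RadonNikodym

variable {E : Type*} [NormedAddCommGroup E] [NormedSpace ℂ E] [CompleteSpace E]

/-- Under the Radon–Nikodým property, a bounded operator on `L¹(μ)` is given by a density. -/
lemma HasRNP.exists_density_of_clm (hE : HasRNP E) (μ : Measure ℝ) [IsFiniteMeasure μ]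
    (L : Lp ℝ 1 μ →L[ℝ] E) :
    ∃ f : ℝ → E, Integrable f μ ∧ ∀ h : Lp ℝ 1 μ, L h = ∫ t, h t • f t ∂μ := by
  classical
  set C := ‖L‖ with hC
  -- The measure to be represented is `s ↦ L(1ₛ)`, with value `0` on non-measurable sets. It is
  -- dominated by `‖L‖ μ`, which gives finite variation and absolute continuity at once.
  let m : Set ℝ → E := fun s =>
    if hs : MeasurableSet s then L (indicatorConstLp 1 hs (measure_ne_top μ s) 1) else 0
  have hm : ∀ s, ‖m s‖ₑ ≤ (ENNReal.ofReal C • μ) s := by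
    intro s
    by_cases hs : MeasurableSet s
    · simp only [m, dif_pos hs, Measure.smul_apply, smul_eq_mul]
      refine (L.le_opENorm _).trans ?_
      rw [← ofReal_norm L]
      gcongr
      refine enorm_indicatorConstLp_le.trans ?_
      simp
    · simp [m, dif_neg hs]
  have : IsFiniteMeasure (ENNReal.ofReal C • μ) := μ.smul_finite ENNReal.ofReal_ne_top
  let ν : VectorMeasure ℝ E := VectorMeasure.of_additive_of_le_measure m hm
    (fun s t hs ht hst => by
      simp only [m, dif_pos hs, dif_pos ht, dif_pos (hs.union ht)]
      rw [indicatorConstLp_disjoint_union hs ht (measure_ne_top μ s) (measure_ne_top μ t) hst,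
        map_add])
    (fun s hs => by simp [m, dif_neg hs])
  have hν : ∀ s (hs : MeasurableSet s),
      ν s = L (indicatorConstLp 1 hs (measure_ne_top μ s) 1) := fun s hs => dif_pos hs
  have hvar : ν.variation ≤ ENNReal.ofReal C • μ :=
    VectorMeasure.variation_le_of_forall_enorm_le fun s _ => hm s
  obtain ⟨f, hf, hfν⟩ := hE ℝ μ ν ((hvar univ).trans_lt (measure_lt_top _ _)) (fun s _ h0 => by
    have := hm s
    rw [Measure.smul_apply, h0, smul_zero, nonpos_iff_eq_zero, enorm_eq_zero] at this
    exact this)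
  -- The variation of `ν` has density `‖f‖` and is at most `C μ`. Boundedness is needed beyond
  -- integrability, because `h • f` must be integrable for every `h` in `L¹`.
  have hbound : ∀ᵐ t ∂μ, ‖f t‖ ≤ C := by
    have e : ν = μ.withDensityᵥ f := by
      ext s hs
      rw [hfν s hs, withDensityᵥ_apply hf hs]
    rw [e, Measure.variation_withDensityᵥ hf] at hvar
    have := ae_le_of_forall_setLIntegral_le_of_sigmaFinite₀ (μ := μ)
      (f := fun t => ‖f t‖ₑ) (g := fun _ => ENNReal.ofReal C) hf.aestronglyMeasurable.enorm
      (fun s hs _ => by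
        rw [← withDensity_apply _ hs, setLIntegral_const]
        exact hvar s)
    filter_upwards [this] with t ht
    rw [← ofReal_norm] at ht
    exact (ENNReal.ofReal_le_ofReal_iff (norm_nonneg _)).1 ht
  have hint : ∀ h : Lp ℝ 1 μ, Integrable (fun t => h t • f t) μ := by
    intro h
    have hh := L1.integrable_coeFn h
    refine Integrable.mono' (hh.norm.mul_const C)
      (hh.aestronglyMeasurable.smul hf.aestronglyMeasurable) ?_
    filter_upwards [hbound] with t ht
    rw [norm_smul]
    gcongr
  let J : Lp ℝ 1 μ →L[ℝ] E := LinearMap.mkContinuous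
    { toFun := fun h => ∫ t, h t • f t ∂μ
      map_add' := fun h k => by
        rw [← integral_add (hint h) (hint k)]
        refine integral_congr_ae ?_
        filter_upwards [Lp.coeFn_add h k] with t ht
        rw [ht, Pi.add_apply, add_smul]
      map_smul' := fun c h => by
        rw [RingHom.id_apply, ← integral_smul]
        refine integral_congr_ae ?_
        filter_upwards [Lp.coeFn_smul c h] with t ht
        rw [ht, Pi.smul_apply, smul_assoc] } C (fun h => by
      change ‖∫ t, h t • f t ∂μ‖ ≤ _
      rw [L1.norm_eq_integral_norm, ← integral_const_mul]
      refine norm_integral_le_of_norm_le ((L1.integrable_coeFn h).norm.const_mul C) ?_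
      filter_upwards [hbound] with t ht
      rw [norm_smul, mul_comm]
      gcongr)
  refine ⟨f, hf, fun h => ?_⟩
  change L h = J h
  refine Lp.induction ENNReal.one_ne_top (fun h => L h = J h) ?_ ?_
    (isClosed_eq L.continuous J.continuous) h
  · intro c s hs hμs
    rw [Lp.simpleFunc.coe_indicatorConst]
    have e : indicatorConstLp 1 hs hμs.ne c = c • indicatorConstLp 1 hs (measure_ne_top μ s) 1 := by
      ext1
      filter_upwards [indicatorConstLp_coeFn (p := 1) (hs := hs) (hμs := hμs.ne) (c := c),
        Lp.coeFn_smul c (indicatorConstLp 1 hs (measure_ne_top μ s) (1 : ℝ)),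
        indicatorConstLp_coeFn (p := 1) (hs := hs) (hμs := measure_ne_top μ s) (c := (1 : ℝ))]
        with t h1 h2 h3
      rw [h1, h2, Pi.smul_apply, h3]
      by_cases ht : t ∈ s <;> simp [ht]
    rw [e, map_smul, map_smul, ← hν s hs, hfν s hs, ← integral_indicator hs]
    congr 1
    change _ = ∫ t, (indicatorConstLp 1 hs (measure_ne_top μ s) (1 : ℝ) : Lp ℝ 1 μ) t • f t ∂μ
    refine integral_congr_ae ?_
    filter_upwards [indicatorConstLp_coeFn (p := 1) (hs := hs) (hμs := measure_ne_top μ s)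
      (c := (1 : ℝ))] with t h3
    rw [h3]
    by_cases ht : t ∈ s <;> simp [ht]
  · intro g k hg hk _ h1 h2
    rw [map_add, map_add, h1, h2]

lemma integrable_testFunction (φ : 𝓓((⊤ : TopologicalSpace.Opens ℝ), ℝ)) (μ : Measure ℝ)
    [IsFiniteMeasure μ] : Integrable (fun t => φ t) μ :=
  φ.continuous.integrable_of_hasCompactSupport φ.hasCompactSupport

/-- Under the Radon–Nikodým property, an operator on test functions that is bounded with respect to
the norm of `L¹(μ)` is given by a density. -/
lemma HasRNP.exists_density (hE : HasRNP E) (μ : Measure ℝ) [IsFiniteMeasure μ]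
    (Λ : 𝓓((⊤ : TopologicalSpace.Opens ℝ), ℝ) →ₗ[ℝ] E) {C : ℝ}
    (hΛ : ∀ φ, ‖Λ φ‖ ≤ C * ∫ t, |φ t| ∂μ) :
    ∃ f : ℝ → E, Integrable f μ ∧ ∀ φ, Λ φ = ∫ t, φ t • f t ∂μ := by
  have hI := fun φ => integrable_testFunction φ μ
  let e : 𝓓((⊤ : TopologicalSpace.Opens ℝ), ℝ) →ₗ[ℝ] Lp ℝ 1 μ :=
    { toFun := fun φ => (hI φ).toL1 _
      map_add' := fun φ ψ => Integrable.toL1_add _ _ (hI φ) (hI ψ)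
      map_smul' := fun c φ => Integrable.toL1_smul _ (hI φ) c }
  have hnorm : ∀ φ, ‖e φ‖ = ∫ t, |φ t| ∂μ := fun φ => L1.norm_of_fun_eq_integral_norm (hI φ)
  -- Smooth compactly supported functions are dense in `L¹(μ)`, so the bound on test functions
  -- determines an extension of `Λ` to all of `L¹(μ)`.
  have hdense : DenseRange e := by
    refine (Lp.dense_hasCompactSupport_contDiff (μ := μ) (F := ℝ) ENNReal.one_ne_top).mono ?_
    rintro h ⟨g, hg, hgc, hgs⟩
    let φ : 𝓓((⊤ : TopologicalSpace.Opens ℝ), ℝ) := ⟨g, hgs, hgc, fun _ _ => trivial⟩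
    refine ⟨φ, ?_⟩
    ext1
    exact (Integrable.coeFn_toL1 (hI φ)).trans hg.symm
  have hb : ∀ φ, ‖Λ φ‖ ≤ C * ‖e φ‖ := fun φ => by
    rw [hnorm]
    exact hΛ φ
  obtain ⟨f, hf, h⟩ := hE.exists_density_of_clm μ (Λ.extendOfNorm e)
  refine ⟨f, hf, fun φ => ?_⟩
  rw [← LinearMap.extendOfNorm_eq hdense ⟨C, hb⟩ φ, h]
  refine integral_congr_ae ?_
  filter_upwards [Integrable.coeFn_toL1 (hI φ)] with t ht
  change (hI φ).toL1 _ t • f t = _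
  rw [ht]

/-- The product of a test function and a smooth function. -/
def mulTest (χ : ℝ → ℝ) (hχ : ContDiff ℝ ∞ χ) :
    𝓓((⊤ : TopologicalSpace.Opens ℝ), ℝ) →ₗ[ℝ] 𝓓((⊤ : TopologicalSpace.Opens ℝ), ℝ) where
  toFun φ := ⟨fun t => χ t * φ t, hχ.mul φ.contDiff, φ.hasCompactSupport.mul_left,
    fun _ _ => trivial⟩
  map_add' φ ψ := by
    ext t
    exact mul_add _ _ _
  map_smul' c φ := by
    ext t
    exact mul_left_comm _ _ _

lemma mulTest_apply {χ : ℝ → ℝ} (hχ : ContDiff ℝ ∞ χ)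
    (φ : 𝓓((⊤ : TopologicalSpace.Opens ℝ), ℝ)) (t : ℝ) : mulTest χ hχ φ t = χ t * φ t := rfl

variable {y : 𝓓'((⊤ : TopologicalSpace.Opens ℝ), E)} {M : ℝ → ℝ}

/-- Multiplying by a cutoff `χ` removes the support condition: `φ ↦ y (χ φ)` is bounded on all test
functions by an `L¹` norm for a finite measure, and agrees with `y` on those supported left of `b`.
-/
lemma HasRNP.exists_density_Ioo (hE : HasRNP E)
    (hM : ∀ a, 0 < a → 0 ≤ M a)
    (hy : ∀ a, 0 < a → ∀ φ : 𝓓((⊤ : TopologicalSpace.Opens ℝ), ℝ), tsupport φ ⊆ Iio a →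
      ‖y φ‖ ≤ M a * ∫ t in (0 : ℝ)..a, |φ t|) {b : ℝ} (hb : 0 < b) :
    ∃ f : ℝ → E, Integrable f ∧ ∀ φ : 𝓓((⊤ : TopologicalSpace.Opens ℝ), ℝ),
      tsupport φ ⊆ Iio b → y φ = ∫ t in Ioo 0 b, φ t • f t := by
  -- This equals `1` left of `b`, and its closed support lies in `Iic (b + 1)`; hence the strict
  -- bound `b + 2` in the estimate.
  let χ : ℝ → ℝ := fun t => Real.smoothTransition (b + 1 - t)
  have hχ : ContDiff ℝ ∞ χ := Real.smoothTransition.contDiff.comp (contDiff_const.sub contDiff_id)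
  have hχ1 : ∀ t, t < b → χ t = 1 := fun t ht =>
    Real.smoothTransition.one_of_one_le (by linarith)
  have hχs : tsupport χ ⊆ Iic (b + 1) := by
    refine closure_minimal (fun t ht => ?_) isClosed_Iic
    by_contra h
    exact ht (Real.smoothTransition.zero_of_nonpos (by linarith [not_le.1 (mt mem_Iic.2 h)]))
  have hb2 : 0 < b + 2 := by linarith
  let Λ : 𝓓((⊤ : TopologicalSpace.Opens ℝ), ℝ) →ₗ[ℝ] E :=
    { toFun := fun φ => y (mulTest χ hχ φ)
      map_add' := fun φ ψ => by rw [map_add, map_add]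
      map_smul' := fun c φ => by rw [map_smul, map_smul, RingHom.id_apply] }
  have hΛ : ∀ φ, ‖Λ φ‖ ≤ M (b + 2) * ∫ t, |φ t| ∂(volume.restrict (Ioc 0 (b + 2))) := by
    intro φ
    have hs : tsupport (mulTest χ hχ φ) ⊆ Iio (b + 2) := by
      refine (tsupport_mul_subset_left (f := χ) (g := fun t => φ t)).trans (hχs.trans ?_)
      exact fun t ht => lt_of_le_of_lt (mem_Iic.1 ht) (by linarith : b + 1 < b + 2)
    refine (hy _ hb2 _ hs).trans ?_
    refine mul_le_mul_of_nonneg_left ?_ (hM _ hb2)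
    rw [intervalIntegral.integral_of_le hb2.le]
    refine integral_mono (integrable_testFunction _ _).abs (integrable_testFunction _ _).abs ?_
    intro t
    simp only [mulTest_apply, abs_mul]
    refine mul_le_of_le_one_left (abs_nonneg _) ?_
    rw [abs_of_nonneg (Real.smoothTransition.nonneg _)]
    exact Real.smoothTransition.le_one _
  obtain ⟨f, hf, h⟩ := hE.exists_density _ Λ hΛ
  refine ⟨(Ioc 0 (b + 2)).indicator f, IntegrableOn.integrable_indicator hf measurableSet_Ioc,
    fun φ hφ => ?_⟩
  have e : mulTest χ hχ φ = φ := by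
    ext t
    rw [mulTest_apply]
    by_cases ht : t < b
    · rw [hχ1 t ht, one_mul]
    · rw [image_eq_zero_of_notMem_tsupport (fun h => ht (hφ h)), mul_zero]
  have h1 : y φ = ∫ t in Ioc 0 (b + 2), φ t • f t := by
    rw [← h φ]
    exact (congrArg y e).symm
  have e2 : ∫ t in Ioo 0 b, φ t • (Ioc 0 (b + 2)).indicator f t = ∫ t in Ioo 0 b, φ t • f t := by
    refine setIntegral_congr_fun measurableSet_Ioo fun t ht => ?_
    rw [indicator_of_mem (mem_Ioc.2 ⟨ht.1, by linarith [ht.2]⟩)]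
  rw [h1, e2]
  refine setIntegral_eq_of_subset_of_forall_sdiff_eq_zero measurableSet_Ioc
    (fun t ht => ⟨ht.1, by linarith [ht.2]⟩) fun t ht => ?_
  rw [image_eq_zero_of_notMem_tsupport (fun h => ht.2 ⟨ht.1.1, hφ h⟩), zero_smul]

/-- Under the Radon–Nikodým property, a distribution that is locally bounded with respect to
`L¹`-norms is a locally bounded function. -/
lemma HasRNP.exists_locallyBounded_density (hE : HasRNP E)
    (hM : ∀ a, 0 < a → 0 ≤ M a)
    (hy : ∀ a, 0 < a → ∀ φ : 𝓓((⊤ : TopologicalSpace.Opens ℝ), ℝ), tsupport φ ⊆ Iio a →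
      ‖y φ‖ ≤ M a * ∫ t in (0 : ℝ)..a, |φ t|) :
    ∃ f : ℝ → E, (∀ a, 0 < a → AEStronglyMeasurable f (volume.restrict (Icc 0 a)) ∧
      ∀ᵐ t ∂(volume.restrict (Icc 0 a)), ‖f t‖ ≤ M a) ∧
      ∀ φ : 𝓓((⊤ : TopologicalSpace.Opens ℝ), ℝ), y φ = ∫ t in Ici (0 : ℝ), φ t • f t := by
  have hex : ∀ n : ℕ, ∃ f : ℝ → E, Integrable f ∧
      ∀ φ : 𝓓((⊤ : TopologicalSpace.Opens ℝ), ℝ), tsupport φ ⊆ Iio ((n : ℝ) + 1) →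
        y φ = ∫ t in Ioo 0 ((n : ℝ) + 1), φ t • f t := fun n =>
    hE.exists_density_Ioo hM hy (by positivity)
  choose F hF hFy using hex
  -- On the common interval both densities represent `y`, so they agree almost everywhere by the
  -- fundamental lemma of the calculus of variations.
  have hcons : ∀ k n : ℕ, k ≤ n → ∀ᵐ t, t ∈ Ioo (0 : ℝ) (k + 1) → F k t = F n t := by
    intro k n hkn
    have hkn' : (k : ℝ) ≤ n := by exact_mod_cast hkn
    have := isOpen_Ioo.ae_eq_zero_of_integral_contDiff_smul_eq_zero (U := Ioo (0 : ℝ) (k + 1))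
      (f := fun t => F k t - F n t) (μ := volume)
      (((hF k).sub (hF n)).locallyIntegrable.locallyIntegrableOn _) (fun g hg hgc hgs => ?_)
    · filter_upwards [this] with t ht htk
      exact sub_eq_zero.1 (ht htk)
    · let φ : 𝓓((⊤ : TopologicalSpace.Opens ℝ), ℝ) := ⟨g, hg, hgc, fun _ _ => trivial⟩
      have key : ∀ j : ℕ, k ≤ j → Integrable (fun t => g t • F j t) ∧
          y φ = ∫ t, g t • F j t := by
        intro j hkj
        have hkj' : (k : ℝ) ≤ j := by exact_mod_cast hkj
        have hsub : tsupport g ⊆ Ioo 0 ((j : ℝ) + 1) :=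
          hgs.trans (Ioo_subset_Ioo_right (by linarith))
        constructor
        · exact (hF j).locallyIntegrable.integrable_smul_left_of_hasCompactSupport
            hg.continuous hgc
        · rw [hFy j φ (hsub.trans Ioo_subset_Iio_self)]
          refine setIntegral_eq_integral_of_forall_compl_eq_zero fun t ht => ?_
          change g t • _ = _
          rw [image_eq_zero_of_notMem_tsupport (fun h => ht (hsub h)), zero_smul]
      simp only [smul_sub]
      rw [integral_sub (key k le_rfl).1 (key n hkn).1, ← (key k le_rfl).2, ← (key n hkn).2,
        sub_self]
  -- Since `t < ⌊t⌋₊ + 1`, the density with index `⌊t⌋₊` is valid at every `t > 0`; and `t < n + 1`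
  -- forces `⌊t⌋₊ ≤ n`, so countably many consistency relations suffice.
  let f : ℝ → E := fun t => F ⌊t⌋₊ t
  have hfF : ∀ n : ℕ, ∀ᵐ t ∂(volume.restrict (Ioo (0 : ℝ) (n + 1))), f t = F n t := by
    intro n
    rw [ae_restrict_iff' measurableSet_Ioo]
    have hall : ∀ᵐ t, ∀ k : ℕ, k ≤ n → t ∈ Ioo (0 : ℝ) (k + 1) → F k t = F n t :=
      ae_all_iff.2 fun k => by
        by_cases hk : k ≤ n
        · filter_upwards [hcons k n hk] with t ht _ using ht
        · exact Eventually.of_forall fun t h => absurd h hk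
    filter_upwards [hall] with t ht htn
    refine ht _ ?_ ⟨htn.1, Nat.lt_floor_add_one t⟩
    refine Nat.lt_succ_iff.1 ((Nat.floor_lt htn.1.le).2 ?_)
    simpa using htn.2
  refine ⟨f, fun a ha => ?_, fun φ => ?_⟩
  · obtain ⟨n, hn⟩ := exists_nat_gt a
    have hsub : Ioo 0 a ⊆ Ioo 0 ((n : ℝ) + 1) := Ioo_subset_Ioo_right (by linarith)
    rw [← Measure.restrict_congr_set (Ioo_ae_eq_Icc (a := (0 : ℝ)) (b := a))]
    have hff := ae_restrict_of_ae_restrict_of_subset hsub (hfF n)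
    refine ⟨((hF n).aestronglyMeasurable.restrict).congr (hff.mono fun t ht => ht.symm), ?_⟩
    -- The cutoff construction alone would give only a constant from a longer interval. Testing
    -- again inside `(0, a)` gives the constant `M a` itself.
    have := ae_norm_le_of_norm_integral_smul_le (f := F n) (M := M a) (a := 0) (b := a)
      (hF n).integrableOn (fun ρ hρ hρc hρs => by
        have h1 := hFy n ⟨ρ, hρ, hρc, fun _ _ => trivial⟩
          (hρs.trans (hsub.trans Ioo_subset_Iio_self))
        have h2 := hy a ha ⟨ρ, hρ, hρc, fun _ _ => trivial⟩ (hρs.trans Ioo_subset_Iio_self)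
        have e : ∫ t in Ioo 0 ((n : ℝ) + 1), ρ t • F n t = ∫ t in Ioo 0 a, ρ t • F n t := by
          refine setIntegral_eq_of_subset_of_forall_sdiff_eq_zero measurableSet_Ioo hsub
            fun t ht => ?_
          rw [image_eq_zero_of_notMem_tsupport (fun h => ht.2 (hρs h)), zero_smul]
        rw [h1, intervalIntegral.integral_of_le ha.le, integral_Ioc_eq_integral_Ioo] at h2
        rw [← e]
        exact h2)
    filter_upwards [this, hff] with t h1 h2
    rw [h2]
    exact h1
  · obtain ⟨r, hr⟩ := φ.hasCompactSupport.isCompact.bddAbove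
    obtain ⟨n, hn⟩ := exists_nat_gt r
    have hs : tsupport φ ⊆ Iio ((n : ℝ) + 1) := fun t ht =>
      lt_of_le_of_lt (hr ht) (by linarith)
    rw [hFy n φ hs, integral_Ici_eq_integral_Ioi]
    have e : ∫ t in Ioi 0, φ t • f t = ∫ t in Ioo 0 ((n : ℝ) + 1), φ t • f t := by
      refine setIntegral_eq_of_subset_of_forall_sdiff_eq_zero measurableSet_Ioi Ioo_subset_Ioi_self
        fun t ht => ?_
      rw [image_eq_zero_of_notMem_tsupport (fun h => ht.2 ⟨ht.1, hs h⟩), zero_smul]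
    rw [e]
    refine integral_congr_ae ?_
    filter_upwards [hfF n] with t ht
    rw [ht]

end RadonNikodym

/-! ### Essential bounds in terms of `eLpNorm` -/

section Bounds

variable {E F : Type*} [NormedAddCommGroup E] [NormedAddCommGroup F]

lemma ae_norm_le_toReal_eLpNorm_top {f : ℝ → E} {μ : Measure ℝ} (hf : MemLp f ∞ μ) :
    ∀ᵐ t ∂μ, ‖f t‖ ≤ (eLpNorm f ∞ μ).toReal := by
  have := ae_le_eLpNormEssSup (f := f) (μ := μ)
  filter_upwards [this] with t ht
  rw [← toReal_enorm]
  refine ENNReal.toReal_mono hf.eLpNorm_ne_top ?_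
  rwa [eLpNorm_exponent_top]

lemma memLp_top_of_ae_norm_le {f : ℝ → E} {g : ℝ → F} {μ : Measure ℝ} (hg : MemLp g ∞ μ) {c : ℝ}
    (hc : 0 ≤ c) (hf : AEStronglyMeasurable f μ)
    (h : ∀ᵐ t ∂μ, ‖f t‖ ≤ (eLpNorm g ∞ μ).toReal * c) :
    MemLp f ∞ μ ∧ eLpNorm f ∞ μ ≤ ENNReal.ofReal c * eLpNorm g ∞ μ := by
  refine ⟨memLp_top_of_bound hf _ h, ?_⟩
  rw [eLpNorm_exponent_top]
  refine (eLpNormEssSup_le_of_ae_bound h).trans (le_of_eq ?_)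
  rw [mul_comm, ENNReal.ofReal_mul hc, ENNReal.ofReal_toReal hg.eLpNorm_ne_top]

lemma memLp_top_of_continuousOn {f : ℝ → E} (hf : ContinuousOn f (Ici 0)) (a : ℝ) :
    MemLp f ∞ (volume.restrict (Icc 0 a)) := by
  have hf' := hf.mono (Icc_subset_Ici_self : Icc 0 a ⊆ Ici 0)
  obtain ⟨C, hC⟩ := isCompact_Icc.exists_bound_of_continuousOn hf'
  refine memLp_top_of_bound (hf'.aestronglyMeasurable measurableSet_Icc) C ?_
  filter_upwards [ae_restrict_mem measurableSet_Icc] with t ht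
  exact hC t ht

end Bounds

/-! ### BIBO stability of the dual node -/

namespace SystemNode

variable {U X Y : Type*} [NormedAddCommGroup U] [NormedSpace ℂ U] [CompleteSpace U]
    [NormedAddCommGroup X] [NormedSpace ℂ X] [CompleteSpace X]
    [NormedAddCommGroup Y] [NormedSpace ℂ Y] [CompleteSpace Y]

/-- A classical dual output is already a continuous function, so the tested bound on `Ioo 0 a` gives
the essential bound directly, without the Radon–Nikodým property. -/
lemma LILOBound.isCinfBIBOStable_dual {N : SystemNode U X Y} {c : ℝ} (hc : N.LILOBound c)
    (hc0 : 0 < c) (hA : GeneratesC0 (adjoint N.A)) : (N.dual hA).IsCinfBIBOStable := by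
  refine ⟨c, hc0, fun η φ θ hsol _ _ _ hφ => ?_⟩
  have key : ∀ a, 0 < a → MemLp θ ∞ (volume.restrict (Icc 0 a)) ∧
      eLpNorm θ ∞ (volume.restrict (Icc 0 a))
        ≤ ENNReal.ofReal c * eLpNorm η ∞ (volume.restrict (Icc 0 a)) := by
    intro a ha
    have hη := memLp_top_of_continuousOn hsol.continuousOn_u a
    have hθ := hsol.continuousOn_y.mono (Icc_subset_Ici_self : Icc 0 a ⊆ Ici 0)
    refine memLp_top_of_ae_norm_le hη hc0.le (hθ.aestronglyMeasurable measurableSet_Icc) ?_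
    rw [← Measure.restrict_congr_set (Ioo_ae_eq_Icc (a := (0 : ℝ)) (b := a))]
    refine ae_norm_le_of_norm_integral_smul_le
      ((hθ.integrableOn_compact isCompact_Icc).mono_set Ioo_subset_Icc_self)
      fun ρ hρ hρc hρs => ?_
    have := hc.norm_integral_smul_le hc0 hA hsol hφ ha ENNReal.toReal_nonneg
      (ae_norm_le_toReal_eLpNorm_top hη) hρ hρc (hρs.trans Ioo_subset_Iio_self)
    rw [intervalIntegral.integral_of_le ha.le, intervalIntegral.integral_of_le ha.le,
      integral_Ioc_eq_integral_Ioo, integral_Ioc_eq_integral_Ioo,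
      ← Measure.restrict_congr_set (Ioo_ae_eq_Icc (a := (0 : ℝ)) (b := a))] at this
    exact this
  exact ⟨fun a ha => (key a ha).1, fun a ha => (key a ha).2⟩

lemma LILOBound.isLinfBIBOStable_dual {N : SystemNode U X Y} {c : ℝ} (hc : N.LILOBound c)
    (hc0 : 0 < c) (hA : GeneratesC0 (adjoint N.A)) (hU : HasRNP (AntiDual U)) :
    (N.dual hA).IsLinfBIBOStable := by
  refine ⟨c, hc0, fun η x y hsol hη hx => ?_⟩
  have h₁ : IsPrimitive (fun t => ∫ s in (0 : ℝ)..t, η s) η := .of_integral fun a ha => by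
    rw [intervalIntegrable_iff_integrableOn_Ioc_of_le ha]
    exact (hsol.locallyIntegrableOn_u.integrableOn_compact_subset Icc_subset_Ici_self
      isCompact_Icc).mono_set Ioc_subset_Icc_self
  have h₂ := IsPrimitive.integral h₁.continuousOn
  -- The bound depends on `a` through the input up to time `a` only, so the final estimate is
  -- causal.
  let M : ℝ → ℝ := fun a => (eLpNorm η ∞ (volume.restrict (Icc 0 a))).toReal * c
  have hy : ∀ a, 0 < a → ∀ φ : 𝓓((⊤ : TopologicalSpace.Opens ℝ), ℝ), tsupport φ ⊆ Iio a →
      ‖y φ‖ ≤ M a * ∫ t in (0 : ℝ)..a, |φ t| := by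
    intro a ha φ hφ
    have hb := hc.norm_integral_iteratedDeriv_smul_le hc0 hA h₁ h₂ ha ENNReal.toReal_nonneg
      (ae_norm_le_toReal_eLpNorm_top (hη a ha)) φ.contDiff φ.hasCompactSupport hφ
    have e := hsol.exists_output hx h₁ h₂ φ
    rw [intervalIntegral.integral_of_le ha.le, ← integral_Icc_eq_integral_Ioc] at hb
    -- The second derivative of the test function vanishes beyond `a`, so the integral over the
    -- half-line reduces to `Icc 0 a`, where the estimate is available.
    rw [e, setIntegral_eq_of_subset_of_forall_sdiff_eq_zero measurableSet_Ici
      (Icc_subset_Ici_self : Icc 0 a ⊆ Ici 0) fun t ht => ?_]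
    · exact hb
    · rw [image_eq_zero_of_notMem_tsupport (f := iteratedDeriv 2 fun r => φ r)]
      · exact zero_smul ℝ (_ : AntiDual U)
      intro h
      exact ht.2 ⟨ht.1, (mem_Iio.1 (hφ (tsupport_iteratedDeriv_subset _ 2 h))).le⟩
  obtain ⟨f, hf, hfy⟩ := hU.exists_locallyBounded_density
    (fun a _ => mul_nonneg ENNReal.toReal_nonneg hc0.le) hy
  have key := fun a ha =>
    memLp_top_of_ae_norm_le (hη a ha) hc0.le (hf a ha).1 (hf a ha).2
  exact ⟨f, fun a ha => (key a ha).1, hfy, fun a ha => (key a ha).2⟩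

end SystemNode

end LinSys

end

theorem mainTheorem2 {U X Y : Type*}
    [NormedAddCommGroup U] [NormedSpace ℂ U] [CompleteSpace U]
    [NormedAddCommGroup X] [NormedSpace ℂ X] [CompleteSpace X]
    [NormedAddCommGroup Y] [NormedSpace ℂ Y] [CompleteSpace Y]
    (N : LinSys.SystemNode U X Y) (hN : N.IsCinfLILOStable)
    (hA : LinSys.GeneratesC0 (LinSys.adjoint N.A)) :
    (N.dual hA).IsCinfBIBOStable ∧
      (LinSys.HasRNP (LinSys.AntiDual U) → (N.dual hA).IsLinfBIBOStable) := by
  obtain ⟨c, hc0, hc⟩ := hN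
  have hc : N.LILOBound c := hc
  exact ⟨hc.isCinfBIBOStable_dual hc0 hA, hc.isLinfBIBOStable_dual hc0 hA⟩
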